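/- For $n\in\mathbb N$, $n\ge 1$, and $\rho\in[0,1)$ let $X_0,X_1,\dots,X_n$ be independent standard normal random variables, and let $I_{0,n}\subseteq\{1,\dots,n\}$ be the set of indices of the true null hypotheses, $\zeta_n=|I_{0,n}|/n$. Let $\Phi$ be the standard normal distribution function. For $i\in I_{0,n}$ the test statistic is $T_i=\sqrt{1-\rho}\,X_i-\sqrt{\rho}\,X_0$ (so that $\operatorname{Var}T_i=1$ and $\operatorname{Cov}(T_i,T_j)=\rho$ for $i\neq j$) and the $p$-value is $p_i=1-\Phi(T_i)$; for $i\notin I_{0,n}$ the hypothesis is totally false, that is, $p_i=0$. Let $p_{1:n}\le\dots\le p_{n:n}$ be the ordered $p$-values. The linear step-up procedure at level $\alpha$ puts $m=\max\{k: p_{k:n}\le k\alpha/n\}$ ($m=0$ if there is no such $k$) and rejects the $i$-th hypothesis iff $p_i\le m\alpha/n$. Let $R_n$ be the number of all rejections, $V_n$ the number of rejections with $i\in I_{0,n}$, and $\operatorname{FDR}_n(\zeta_n)=\mathbb E\bigl[V_n/\max(R_n,1)\bigr]$. Let $\alpha\in(0,1/2]$ and suppose that $\zeta_n\to1$ as $n\to\infty$.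 Then for every $\rho\in[0,1)$ the limit $$\operatorname{FDR}_\infty(1)=\operatorname{FDR}_\infty(1)(\rho)=\lim_{n\to\infty}\operatorname{FDR}_n(\zeta_n)$$ exists, and $$\lim_{\rho\to0^+}\operatorname{FDR}_\infty(1)(\rho)=\Phi\bigl(-\sqrt{-2\ln\alpha}\bigr)<\alpha=\operatorname{FDR}_\infty(1)(0).$$ In particular, $\rho\mapsto\operatorname{FDR}_\infty(1)(\rho)$ on $[0,1)$ is discontinuous at $\rho=0$ (independence). -/

import Mathlib

open MeasureTheory ProbabilityTheory Filter Topology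

noncomputable section

namespace EquiNormal

/-- The cumulative distribution function `Φ` of the standard normal distribution. -/
def Phi (x : ℝ) : ℝ := cdf (gaussianReal 0 1) x

/-- The index `m` of the linear step-up procedure at level `α` for the p-values `p`, that is,
`m = max {k | p_{k:n} ≤ k α / n}`, and `m = 0` if there is no such `k`.
Here `p (Tuple.sort p k)` is the order statistic `p_{k+1:n}`, since `Fin n` counts from `0`. -/
def stepUpIndex {n : ℕ} (α : ℝ) (p : Fin n → ℝ) : ℕ :=
  (Finset.univ.filter fun k : Fin n => p (Tuple.sort p k) ≤ ((k : ℕ) + 1 : ℝ) * α / n).sup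
    fun k => (k : ℕ) + 1

/-- The set of hypotheses rejected by the linear step-up procedure: those whose p-value is at
most the threshold `m α / n`. -/
def rejected {n : ℕ} (α : ℝ) (p : Fin n → ℝ) : Finset (Fin n) :=
  Finset.univ.filter fun i => p i ≤ (stepUpIndex α p : ℝ) * α / n

/-- The false discovery proportion `V / (R ∨ 1)`, where `R` is the number of all rejections and
`V` is the number of rejected hypotheses that are true, `I₀` being the set of true hypotheses. -/
def fdp {n : ℕ} (α : ℝ) (I₀ : Finset (Fin n)) (p : Fin n → ℝ) : ℝ :=
  ((rejected α p ∩ I₀).card : ℝ) / ((max (rejected α p).card 1 : ℕ) : ℝ)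

/-- The p-values in the equi-correlated normal model with extreme alternatives.
For a true hypothesis (`ϑ_i = 0`, `i ∈ I₀`) the test statistic is
`T_i = √(1 - ρ) X_i - √ρ X_0` and the p-value is `1 - Φ(T_i)`; for a (totally) false
hypothesis (`ϑ_i = ∞`) the p-value is `0`. The vector `x` holds `(x_0, x_1, …, x_n)`. -/
def pValue {n : ℕ} (ρ : ℝ) (I₀ : Finset (Fin n)) (x : Fin (n + 1) → ℝ) (i : Fin n) : ℝ :=
  if i ∈ I₀ then 1 - Phi (√(1 - ρ) * x i.succ - √ρ * x 0) else 0

/-- The false discovery rate `E[V / (R ∨ 1)]` of the linear step-up procedure at level `α` in the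
equi-correlated normal model, `X = (X_0, X_1, …, X_n)` being the underlying random variables. -/
def FDR {n : ℕ} (α ρ : ℝ) (I₀ : Finset (Fin n)) {Ω : Type*} [MeasurableSpace Ω]
    (P : Measure Ω) (X : Fin (n + 1) → Ω → ℝ) : ℝ :=
  ∫ ω, fdp α I₀ (pValue ρ I₀ fun j => X j ω) ∂P

end EquiNormal

end

/-! Condition on `X_0 = x`. The true p-values are then i.i.d. with a distribution function `F_x`
given by `F_x(1 - Φ(u)) = 1 - Φ((u + √ρ x)/√(1 - ρ))` (`cdf_modelPValue`), and the procedure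
compares their empirical distribution function with the Simes line `t/α`.

For `0 < ρ < 1` there is a dichotomy. If `F_x` exceeds the line at some `t`, then eventually a fixed
fraction of all hypotheses is rejected, almost all of them true because `ζ_n → 1`, and the
conditional FDR tends to 1 (`tendsto_fdr_one`). If `F_x` stays strictly below the line, then, since
also `F_x(t)/t → 0` as `t → 0`, it tends to 0 (`tendsto_fdr_zero`). Touching without crossing occurs
for at most one `x`. Dominated convergence gives the limit `P(X_0 ∈ crossingSet α ρ)`.

Now let `ρ → 0`. With `v = (u + √ρ x)/√(1 - ρ)` and `u = w/√ρ`, the Mills ratio bounds give that the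
logarithm of `(1 - Φ(v))/(1 - Φ(u))` is about `v (u - v) ≈ -w x - w²/2`. For `x < 0` the maximum
over `w > 0` is `x²/2`, so crossing means `x²/2 > -ln α`, that is, `x < -√(-2 ln α)`. The crossing
set is a lower set, so its measure tends to `Φ(-√(-2 ln α))`.

For `ρ = 0` the p-values are uniform and the FDR is exactly `ζ_n α` by a leave-one-out identity
(`integral_fdp_eq`), hence the jump. -/

noncomputable section

namespace EquiNormal

/-! ### The upper tail of the standard normal distribution -/

/-- The standard normal density. -/
def gaussDensity (x : ℝ) : ℝ := (√(2 * Real.pi))⁻¹ * Real.exp (-x ^ 2 / 2)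

/-- The upper tail `1 - Φ` of the standard normal distribution. -/
def upperTail (x : ℝ) : ℝ := 1 - Phi x

lemma gaussianPDFReal_zero_one : gaussianPDFReal 0 1 = gaussDensity := by
  ext x; simp [gaussianPDFReal, gaussDensity]

lemma gaussDensity_pos (x : ℝ) : 0 < gaussDensity x := by
  unfold gaussDensity; positivity

lemma sqrt_two_pi_gt : 2 < √(2 * Real.pi) := by
  apply Real.lt_sqrt_of_sq_lt
  nlinarith [Real.pi_gt_three]

lemma gaussDensity_le_one (x : ℝ) : gaussDensity x ≤ 1 := by
  unfold gaussDensity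
  have h1 : (√(2 * Real.pi))⁻¹ ≤ 1 := inv_le_one_of_one_le₀ (by linarith [sqrt_two_pi_gt])
  have h2 : Real.exp (-x ^ 2 / 2) ≤ 1 := Real.exp_le_one_iff.2 (by nlinarith [sq_nonneg x])
  exact mul_le_one₀ h1 (Real.exp_pos _).le h2

lemma continuous_gaussDensity : Continuous gaussDensity := by
  unfold gaussDensity; fun_prop

lemma hasDerivAt_gaussDensity (x : ℝ) : HasDerivAt gaussDensity (-x * gaussDensity x) x := by
  have h : HasDerivAt (fun x : ℝ => -x ^ 2 / 2) (-x) x := by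
    have := ((hasDerivAt_id x).pow 2).neg.div_const 2
    convert! this using 1
    simp
    ring
  have := (h.exp).const_mul (√(2 * Real.pi))⁻¹
  convert! this using 1
  unfold gaussDensity; ring

lemma tendsto_gaussDensity_atTop : Tendsto gaussDensity atTop (𝓝 0) := by
  have h : Tendsto (fun x : ℝ => -x ^ 2 / 2) atTop atBot := by
    have h0 : Tendsto (fun x : ℝ => x ^ 2 / 2) atTop atTop :=
      (tendsto_pow_atTop two_ne_zero).atTop_div_const two_pos
    simpa only [neg_div] using! tendsto_neg_atTop_atBot.comp h0
  have := (Real.tendsto_exp_atBot.comp h).const_mul (√(2 * Real.pi))⁻¹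
  rw [mul_zero] at this
  exact this

lemma Phi_eq_integral (x : ℝ) : Phi x = ∫ y in Set.Iic x, gaussDensity y := by
  rw [Phi, cdf_eq_real, Measure.real, gaussianReal_apply_eq_integral 0 one_ne_zero,
    ENNReal.toReal_ofReal (integral_nonneg fun y => gaussianPDFReal_nonneg 0 1 y),
    gaussianPDFReal_zero_one]

lemma integrable_gaussDensity : Integrable gaussDensity := by
  rw [← gaussianPDFReal_zero_one]; exact integrable_gaussianPDFReal 0 1

lemma hasDerivAt_Phi (x : ℝ) : HasDerivAt Phi (gaussDensity x) x := by
  have h : Phi = fun x => Phi 0 + ∫ y in (0 : ℝ)..x, gaussDensity y := by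
    ext x
    rw [Phi_eq_integral, Phi_eq_integral, ← intervalIntegral.integral_Iic_sub_Iic
      integrable_gaussDensity.integrableOn integrable_gaussDensity.integrableOn]
    ring
  rw [h]
  exact (intervalIntegral.integral_hasDerivAt_right
    integrable_gaussDensity.intervalIntegrable
    continuous_gaussDensity.stronglyMeasurable.stronglyMeasurableAtFilter
    continuous_gaussDensity.continuousAt).const_add _

lemma hasDerivAt_upperTail (x : ℝ) : HasDerivAt upperTail (-gaussDensity x) x :=
  (hasDerivAt_Phi x).const_sub 1

lemma continuous_Phi : Continuous Phi :=
  continuous_iff_continuousAt.2 fun x => (hasDerivAt_Phi x).continuousAt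

lemma continuous_upperTail : Continuous upperTail :=
  continuous_iff_continuousAt.2 fun x => (hasDerivAt_upperTail x).continuousAt

lemma strictAnti_upperTail : StrictAnti upperTail :=
  strictAnti_of_deriv_neg fun x => by
    rw [(hasDerivAt_upperTail x).deriv]; exact neg_neg_of_pos (gaussDensity_pos x)

lemma tendsto_upperTail_atTop : Tendsto upperTail atTop (𝓝 0) := by
  have := (tendsto_cdf_atTop (gaussianReal 0 1)).const_sub 1
  simpa [upperTail, Phi] using! this

lemma tendsto_upperTail_atBot : Tendsto upperTail atBot (𝓝 1) := by
  have := (tendsto_cdf_atBot (gaussianReal 0 1)).const_sub 1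
  simpa [upperTail, Phi] using! this

lemma upperTail_pos (x : ℝ) : 0 < upperTail x :=
  lt_of_le_of_lt (by simpa [upperTail, Phi] using cdf_le_one (gaussianReal 0 1) (x + 1))
    (strictAnti_upperTail (lt_add_one x))

lemma upperTail_lt_one (x : ℝ) : upperTail x < 1 :=
  lt_of_lt_of_le (strictAnti_upperTail (sub_one_lt x))
    (by simpa [upperTail, Phi] using cdf_nonneg (gaussianReal 0 1) (x - 1))

lemma exists_upperTail_eq {t : ℝ} (h0 : 0 < t) (h1 : t < 1) : ∃ u, upperTail u = t := by
  obtain ⟨a, ha⟩ := (tendsto_upperTail_atTop.eventually (gt_mem_nhds h0)).exists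
  obtain ⟨b, hb⟩ := (tendsto_upperTail_atBot.eventually (lt_mem_nhds h1)).exists
  exact mem_range_of_exists_le_of_exists_ge continuous_upperTail ⟨a, ha.le⟩ ⟨b, hb.le⟩

lemma gaussianReal_real_Ici (u : ℝ) : (gaussianReal 0 1).real (Set.Ici u) = upperTail u := by
  have := nullSingletonClass_gaussianReal (μ := 0) (v := 1) one_ne_zero
  rw [upperTail, Phi, cdf_eq_real, ← probReal_compl_eq_one_sub measurableSet_Iic, Set.compl_Iic]
  exact measureReal_congr Ioi_ae_eq_Ici.symm

lemma upperTail_neg (u : ℝ) : upperTail (-u) = Phi u := by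
  rw [← gaussianReal_real_Ici, Phi, cdf_eq_real]
  have h : (gaussianReal 0 1).map (fun x => -x) = gaussianReal 0 1 := by
    simpa using gaussianReal_map_neg (μ := 0) (v := 1)
  conv_lhs => rw [← h]
  rw [map_measureReal_apply measurable_neg measurableSet_Ici]
  congr 1
  ext x; simp

lemma upperTail_zero : upperTail 0 = 1 / 2 := by
  have h := upperTail_neg 0
  have h2 : upperTail 0 = 1 - Phi 0 := rfl
  rw [neg_zero] at h
  linarith

/-! ### Mills ratio bounds -/

/-- Both Mills bounds are proved alike: the difference of the two sides, suitably divided, is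
decreasing and vanishes at infinity, hence is nonnegative. -/
lemma upperTail_le_density_div {x : ℝ} (hx : 0 < x) : x * upperTail x ≤ gaussDensity x := by
  have hd : ∀ y ∈ Set.Ici x, HasDerivAt (fun y => gaussDensity y / y - upperTail y)
      (-(gaussDensity y / y ^ 2)) y := by
    intro y hy
    have hy0 : y ≠ 0 := (hx.trans_le hy).ne'
    convert! ((hasDerivAt_gaussDensity y).div (hasDerivAt_id y) hy0).sub (hasDerivAt_upperTail y)
      using 1
    simp only [id]
    field_simp
    ring
  have hanti : AntitoneOn (fun y => gaussDensity y / y - upperTail y) (Set.Ici x) := by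
    refine antitoneOn_of_deriv_nonpos (convex_Ici x)
      (fun y hy => (hd y hy).continuousAt.continuousWithinAt)
      (fun y hy => (hd y (interior_subset hy)).differentiableAt.differentiableWithinAt) ?_
    intro y hy
    rw [(hd y (interior_subset hy)).deriv]
    have := gaussDensity_pos y
    exact neg_nonpos.2 (by positivity)
  have hlim : Tendsto (fun y => gaussDensity y / y - upperTail y) atTop (𝓝 0) := by
    simpa using (tendsto_gaussDensity_atTop.div_atTop tendsto_id).sub tendsto_upperTail_atTop
  have h0 : 0 ≤ gaussDensity x / x - upperTail x :=
    le_of_tendsto hlim (eventually_atTop.2 ⟨x, fun y hy => hanti (Set.mem_Ici.2 le_rfl) hy hy⟩)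
  rw [sub_nonneg, le_div_iff₀ hx] at h0
  linarith

lemma density_le_mul_upperTail {x : ℝ} (hx : 0 < x) :
    gaussDensity x ≤ (x + 1 / x) * upperTail x := by
  have hd : ∀ y, HasDerivAt (fun y => upperTail y - gaussDensity y * (y / (y ^ 2 + 1)))
      (-(2 * gaussDensity y / (y ^ 2 + 1) ^ 2)) y := by
    intro y
    have hy0 : y ^ 2 + 1 ≠ 0 := by positivity
    have hq := (hasDerivAt_id y).div (((hasDerivAt_id y).pow 2).add_const 1) hy0
    convert! (hasDerivAt_upperTail y).sub ((hasDerivAt_gaussDensity y).mul hq) using 1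
    simp only [id, Pi.pow_apply, Pi.div_apply]
    field_simp
    ring
  have hanti : Antitone (fun y => upperTail y - gaussDensity y * (y / (y ^ 2 + 1))) := by
    refine antitone_of_deriv_nonpos (fun y => (hd y).differentiableAt) fun y => ?_
    rw [(hd y).deriv]
    have := gaussDensity_pos y
    exact neg_nonpos.2 (by positivity)
  have hlim : Tendsto (fun y => upperTail y - gaussDensity y * (y / (y ^ 2 + 1))) atTop (𝓝 0) := by
    have hb : Tendsto (fun y => gaussDensity y * (y / (y ^ 2 + 1))) atTop (𝓝 0) := by
      refine squeeze_zero' ?_ ?_ tendsto_gaussDensity_atTop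
      · filter_upwards [eventually_ge_atTop 0] with y hy
        have := gaussDensity_pos y
        positivity
      · filter_upwards with y
        refine mul_le_of_le_one_right (gaussDensity_pos y).le ?_
        rw [div_le_one (by positivity)]
        nlinarith [sq_nonneg (y - 1)]
    simpa using tendsto_upperTail_atTop.sub hb
  have h0 := le_of_tendsto hlim (eventually_atTop.2 ⟨x, fun y hy => hanti hy⟩)
  have h1 : gaussDensity x * (x / (x ^ 2 + 1)) ≤ upperTail x := by simpa using h0
  have h2 : x + 1 / x = (x ^ 2 + 1) / x := by field_simp
  rw [h2, div_mul_eq_mul_div, le_div_iff₀ hx]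
  rw [← mul_div_assoc, div_le_iff₀ (by positivity)] at h1
  linarith

/-- Mean value theorem for the logarithm of the tail. The hazard rate at `ξ > 0` lies between `ξ`
and `ξ + 1/ξ`, which yields the two estimates of log-tail differences below. -/
lemma log_upperTail_sub {v u : ℝ} (hvu : v < u) : ∃ ξ ∈ Set.Ioo v u,
    Real.log (upperTail v) - Real.log (upperTail u) =
      gaussDensity ξ / upperTail ξ * (u - v) := by
  have hd : ∀ y, HasDerivAt (fun y => Real.log (upperTail y)) (-gaussDensity y / upperTail y) y :=
    fun y => (hasDerivAt_upperTail y).log (upperTail_pos y).ne'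
  obtain ⟨ξ, hξ, h⟩ := exists_hasDerivAt_eq_slope (fun y => Real.log (upperTail y)) _ hvu
    (fun y _ => (hd y).continuousAt.continuousWithinAt) (fun y _ => hd y)
  refine ⟨ξ, hξ, ?_⟩
  rw [eq_div_iff (sub_pos.2 hvu).ne', neg_div] at h
  linarith

lemma mul_sub_le_log_upperTail {v u : ℝ} (hv : 0 < v) (hvu : v < u) :
    v * (u - v) ≤ Real.log (upperTail v) - Real.log (upperTail u) := by
  obtain ⟨ξ, hξ, h⟩ := log_upperTail_sub hvu
  rw [h]
  refine mul_le_mul_of_nonneg_right ?_ (sub_pos.2 hvu).le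
  rw [le_div_iff₀ (upperTail_pos ξ)]
  exact (mul_le_mul_of_nonneg_right hξ.1.le (upperTail_pos ξ).le).trans
    (upperTail_le_density_div (hv.trans hξ.1))

lemma log_upperTail_le_mul_sub {v u : ℝ} (hv : 0 < v) (hvu : v < u) :
    Real.log (upperTail v) - Real.log (upperTail u) ≤ (u + 1 / v) * (u - v) := by
  obtain ⟨ξ, hξ, h⟩ := log_upperTail_sub hvu
  rw [h]
  refine mul_le_mul_of_nonneg_right ?_ (sub_pos.2 hvu).le
  have hξ0 := hv.trans hξ.1
  have : gaussDensity ξ / upperTail ξ ≤ ξ + 1 / ξ := by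
    rw [div_le_iff₀ (upperTail_pos ξ)]; exact density_le_mul_upperTail hξ0
  exact this.trans (add_le_add hξ.2.le (one_div_le_one_div_of_le hv hξ.1.le))

lemma upperTail_sub_le {v u : ℝ} (hvu : v ≤ u) : upperTail v - upperTail u ≤ u - v := by
  rcases hvu.eq_or_lt with rfl | hvu
  · simp
  obtain ⟨ξ, hξ, h⟩ := exists_hasDerivAt_eq_slope upperTail _ hvu
    continuous_upperTail.continuousOn (fun y _ => hasDerivAt_upperTail y)
  rw [eq_div_iff (sub_pos.2 hvu).ne'] at h
  nlinarith [gaussDensity_le_one ξ]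

/-- For `α ≤ 1/2` the limiting value of the false discovery rate is smaller than `α`. -/
lemma Phi_neg_sqrt_lt {α : ℝ} (hα0 : 0 < α) (hα : α ≤ 1 / 2) :
    Phi (-√(-2 * Real.log α)) < α := by
  set y := √(-2 * Real.log α) with hy
  have hlog : Real.log α ≤ -Real.log 2 := by
    rw [← Real.log_inv]; exact Real.log_le_log hα0 (by simpa using hα)
  have hl2 := Real.log_two_gt_d9
  have hsq : y ^ 2 = -2 * Real.log α := Real.sq_sqrt (by linarith)
  -- Here `α ≤ 1/2` enters: `-2 ln α ≥ 2 ln 2 > 1`. The Mills bound then gives `Φ(-y) ≤ y Φ(-y) ≤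
  -- α/√(2π) < α`.
  have hy1 : 1 ≤ y := Real.one_le_sqrt.2 (by linarith)
  have hden : gaussDensity y = (√(2 * Real.pi))⁻¹ * α := by
    unfold gaussDensity
    rw [hsq]
    congr 1
    rw [show -(-2 * Real.log α) / 2 = Real.log α by ring, Real.exp_log hα0]
  have h1 := upperTail_le_density_div (x := y) (by linarith)
  have h2 : upperTail y = Phi (-y) := by rw [← upperTail_neg, neg_neg]
  rw [h2, hden] at h1
  have h3 : (√(2 * Real.pi))⁻¹ < 1 := inv_lt_one_of_one_lt₀ (by linarith [sqrt_two_pi_gt])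
  have h4 : 0 < Phi (-y) := h2 ▸ upperTail_pos y
  nlinarith

/-! ### The linear step-up procedure -/

/-- The number of p-values that are at most `c`. -/
def countLE {n : ℕ} (p : Fin n → ℝ) (c : ℝ) : ℕ := (Finset.univ.filter fun i => p i ≤ c).card

section StepUp

variable {n : ℕ} {α : ℝ} {p : Fin n → ℝ}

lemma countLE_le (c : ℝ) : countLE p c ≤ n := by
  simpa using! Finset.card_le_univ (Finset.univ.filter fun i => p i ≤ c)

lemma countLE_mono {c d : ℝ} (h : c ≤ d) : countLE p c ≤ countLE p d :=
  Finset.card_le_card (Finset.monotone_filter_right _ fun _ _ hi => le_trans hi h)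

lemma sort_le_iff_lt_countLE (k : Fin n) (c : ℝ) :
    p (Tuple.sort p k) ≤ c ↔ (k : ℕ) < countLE p c := by
  rw [countLE, ← Finset.card_equiv (Tuple.sort p)
    (s := Finset.univ.filter fun i => (p ∘ Tuple.sort p) i ≤ c) (by simp)]
  exact (Tuple.lt_card_le_iff_apply_le_of_monotone (Tuple.monotone_sort p)).symm

/-- Together with `le_stepUpIndex` this characterises the index, without order statistics, as the
largest `k` such that at least `k` p-values are at most `kα/n`; `k = 0` always qualifies. -/
lemma stepUpIndex_le_countLE (p : Fin n → ℝ) (α : ℝ) :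
    stepUpIndex α p ≤ countLE p ((stepUpIndex α p : ℝ) * α / n) := by
  rcases (Finset.univ.filter fun k : Fin n =>
    p (Tuple.sort p k) ≤ ((k : ℕ) + 1 : ℝ) * α / n).eq_empty_or_nonempty with h | h
  · have : stepUpIndex α p = 0 := by rw [stepUpIndex, h]; rfl
    simp [this]
  · obtain ⟨k, hk, hkm⟩ := Finset.exists_mem_eq_sup _ h fun k : Fin n => (k : ℕ) + 1
    have hm : stepUpIndex α p = (k : ℕ) + 1 := hkm
    have hk2 := (Finset.mem_filter.1 hk).2
    rw [sort_le_iff_lt_countLE] at hk2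
    rw [hm]
    push_cast
    exact hk2

lemma le_stepUpIndex {k : ℕ} (h : k ≤ countLE p ((k : ℝ) * α / n)) : k ≤ stepUpIndex α p := by
  rcases k with _ | k
  · exact Nat.zero_le _
  have hkn : k < n := h.trans (countLE_le _)
  refine Finset.le_sup (f := fun k : Fin n => (k : ℕ) + 1) (b := ⟨k, hkn⟩) ?_
  rw [Finset.mem_filter, sort_le_iff_lt_countLE]
  push_cast at h
  exact ⟨Finset.mem_univ _, h⟩

lemma stepUpIndex_le : stepUpIndex α p ≤ n :=
  (stepUpIndex_le_countLE p α).trans (countLE_le _)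

lemma level_mono (hα : 0 ≤ α) {k l : ℕ} (h : k ≤ l) : (k : ℝ) * α / n ≤ (l : ℝ) * α / n := by
  have : (k : ℝ) ≤ l := by exact_mod_cast h
  gcongr

lemma card_rejected (hα : 0 ≤ α) : (rejected α p).card = stepUpIndex α p := by
  refine le_antisymm ?_ (stepUpIndex_le_countLE p α)
  exact le_stepUpIndex (countLE_mono (level_mono hα (stepUpIndex_le_countLE p α)))

/-- The index of the step-up procedure after the `i`-th p-value has been replaced by `0`. -/
def stepUpIndexZeroed (α : ℝ) (p : Fin n → ℝ) (i : Fin n) : ℕ :=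
  stepUpIndex α (Function.update p i 0)

lemma countLE_le_countLE_update {c : ℝ} (hc : 0 ≤ c) (i : Fin n) :
    countLE p c ≤ countLE (Function.update p i 0) c := by
  refine Finset.card_le_card (Finset.monotone_filter_right _ fun j _ hj => ?_)
  by_cases h : j = i
  · subst h; simpa using hc
  · simpa [h] using hj

lemma countLE_update_eq {c : ℝ} (hc : 0 ≤ c) {i : Fin n} (hi : p i ≤ c) :
    countLE (Function.update p i 0) c = countLE p c := by
  refine le_antisymm (Finset.card_le_card (Finset.monotone_filter_right _ fun j _ hj => ?_))
    (countLE_le_countLE_update hc i)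
  by_cases h : j = i
  · subst h; exact hi
  · simpa [h] using hj

lemma countLE_update_le {c : ℝ} (i : Fin n) :
    countLE (Function.update p i 0) c ≤ countLE p c + 1 := by
  refine (Finset.card_le_card (t := insert i (Finset.univ.filter fun j => p j ≤ c))
    fun j hj => ?_).trans (Finset.card_insert_le _ _)
  by_cases h : j = i
  · subst h; exact Finset.mem_insert_self _ _
  · simpa [h] using hj

lemma level_nonneg (hα : 0 ≤ α) (k : ℕ) : 0 ≤ (k : ℝ) * α / n := by positivity

lemma stepUpIndex_le_zeroed (hα : 0 ≤ α) (i : Fin n) :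
    stepUpIndex α p ≤ stepUpIndexZeroed α p i :=
  le_stepUpIndex ((stepUpIndex_le_countLE p α).trans
    (countLE_le_countLE_update (level_nonneg hα _) i))

lemma one_le_zeroed (hα : 0 ≤ α) (i : Fin n) : 1 ≤ stepUpIndexZeroed α p i := by
  refine le_stepUpIndex (Finset.one_le_card.2 ⟨i, ?_⟩)
  simpa using! level_nonneg (n := n) hα 1

/-- If `p i` is already below the threshold, setting it to `0` leaves the count at that threshold
unchanged. So rejection of `i` amounts to comparing `p i` with a threshold that does not depend on
`p i`. -/
lemma zeroed_eq_of_le (hα : 0 ≤ α) {i : Fin n}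
    (h : p i ≤ (stepUpIndexZeroed α p i : ℝ) * α / n) :
    stepUpIndex α p = stepUpIndexZeroed α p i := by
  refine le_antisymm (stepUpIndex_le_zeroed hα i) (le_stepUpIndex ?_)
  rw [← countLE_update_eq (level_nonneg hα _) h]
  exact stepUpIndex_le_countLE _ _

lemma mem_rejected_iff (hα : 0 ≤ α) (i : Fin n) :
    i ∈ rejected α p ↔ p i ≤ (stepUpIndexZeroed α p i : ℝ) * α / n := by
  rw [rejected, Finset.mem_filter]
  constructor
  · exact fun h => h.2.trans (level_mono hα (stepUpIndex_le_zeroed hα i))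
  · intro h
    rw [zeroed_eq_of_le hα h]
    exact ⟨Finset.mem_univ _, h⟩

/-- The false discovery proportion in terms of the leave-one-out indices. -/
lemma fdp_eq_sum (hα : 0 ≤ α) (I₀ : Finset (Fin n)) :
    fdp α I₀ p = ∑ i ∈ I₀, if p i ≤ (stepUpIndexZeroed α p i : ℝ) * α / n
      then (stepUpIndexZeroed α p i : ℝ)⁻¹ else 0 := by
  have h : ∀ i ∈ I₀, (if p i ≤ (stepUpIndexZeroed α p i : ℝ) * α / n
      then (stepUpIndexZeroed α p i : ℝ)⁻¹ else 0) =
      if i ∈ rejected α p then ((max (rejected α p).card 1 : ℕ) : ℝ)⁻¹ else 0 := by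
    intro i _
    simp only [mem_rejected_iff hα]
    split_ifs with hi
    · rw [card_rejected hα, zeroed_eq_of_le hα hi, max_eq_left (one_le_zeroed hα i)]
    · rfl
  rw [Finset.sum_congr rfl h, Finset.sum_ite_mem, Finset.sum_const, nsmul_eq_mul, fdp,
    Finset.inter_comm, div_eq_mul_inv]

lemma fdp_nonneg (I₀ : Finset (Fin n)) : 0 ≤ fdp α I₀ p := by unfold fdp; positivity

lemma fdp_le_one (I₀ : Finset (Fin n)) : fdp α I₀ p ≤ 1 := by
  unfold fdp
  refine div_le_one_of_le₀ ?_ (by positivity)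
  exact_mod_cast (Finset.card_le_card Finset.inter_subset_left).trans (le_max_left _ _)

/-- The false discovery proportion is close to one if there are many rejections. -/
lemma one_sub_le_fdp (hα : 0 ≤ α) (I₀ : Finset (Fin n)) {c : ℝ} (hc : 0 < c)
    (h : c ≤ stepUpIndex α p) : 1 - ((n : ℝ) - I₀.card) / c ≤ fdp α I₀ p := by
  have hm : 1 ≤ stepUpIndex α p := by
    have : (0 : ℝ) < stepUpIndex α p := hc.trans_le h
    exact_mod_cast this
  have hm0 : (0 : ℝ) < stepUpIndex α p := by exact_mod_cast hm
  have hcard : (stepUpIndex α p : ℝ) ≤ (rejected α p ∩ I₀).card + ((n : ℝ) - I₀.card) := by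
    have h1 := Finset.card_inter_add_card_sdiff (rejected α p) I₀
    have h2 : (rejected α p \ I₀).card ≤ I₀ᶜ.card :=
      Finset.card_le_card fun i hi => by simpa using! (Finset.mem_sdiff.1 hi).2
    have h3 : I₀.card + I₀ᶜ.card = n := by simp
    rw [card_rejected hα] at h1
    have h1' : ((rejected α p ∩ I₀).card : ℝ) + (rejected α p \ I₀).card = stepUpIndex α p := by
      exact_mod_cast h1
    have h2' : ((rejected α p \ I₀).card : ℝ) ≤ I₀ᶜ.card := by exact_mod_cast h2
    have h3' : (I₀.card : ℝ) + I₀ᶜ.card = n := by exact_mod_cast h3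
    linarith
  have hn : (0 : ℝ) ≤ (n : ℝ) - I₀.card := by
    have : (I₀.card : ℝ) ≤ n := by exact_mod_cast (by simpa using! Finset.card_le_univ I₀)
    linarith
  rw [fdp, card_rejected hα, max_eq_left hm]
  calc 1 - ((n : ℝ) - I₀.card) / c ≤ 1 - ((n : ℝ) - I₀.card) / stepUpIndex α p := by gcongr
    _ = ((stepUpIndex α p : ℝ) - ((n : ℝ) - I₀.card)) / stepUpIndex α p := by field_simp
    _ ≤ _ := by gcongr; linarith

lemma stepUpIndex_congr {q : Fin n → ℝ}
    (h : ∀ i (k : Fin (n + 1)), p i ≤ (k : ℝ) * α / n ↔ q i ≤ (k : ℝ) * α / n) :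
    stepUpIndex α p = stepUpIndex α q := by
  have hc : ∀ k : ℕ, k ≤ n → countLE p ((k : ℝ) * α / n) = countLE q ((k : ℝ) * α / n) := by
    intro k hk
    have := fun i => h i ⟨k, Nat.lt_succ_of_le hk⟩
    simp only [countLE]
    congr 1
    ext i
    simpa using this i
  refine le_antisymm (le_stepUpIndex ?_) (le_stepUpIndex ?_)
  · rw [← hc _ stepUpIndex_le]; exact stepUpIndex_le_countLE p α
  · rw [hc _ stepUpIndex_le]; exact stepUpIndex_le_countLE q α

lemma measurable_stepUpIndex (α : ℝ) : Measurable (fun p : Fin n → ℝ => stepUpIndex α p) := by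
  refine measurable_to_countable' fun m => ?_
  -- The index depends only on the finitely many truth values of `p i ≤ kα/n`, so each fibre is a
  -- finite union of cells, one for each pattern `B` of truth values.
  have key : (fun p : Fin n → ℝ => stepUpIndex α p) ⁻¹' {m} =
      ⋃ B ∈ {B : Fin n → Fin (n + 1) → Prop | ∃ q : Fin n → ℝ, stepUpIndex α q = m ∧
        ∀ i k, B i k ↔ q i ≤ ((k : ℕ) : ℝ) * α / n},
        ⋂ i, ⋂ k : Fin (n + 1), {p | p i ≤ ((k : ℕ) : ℝ) * α / n ↔ B i k} := by
    ext p
    simp only [Set.mem_preimage, Set.mem_singleton_iff, Set.mem_iUnion, Set.mem_iInter,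
      Set.mem_ofPred_eq, exists_prop]
    constructor
    · exact fun h => ⟨fun i k => p i ≤ ((k : ℕ) : ℝ) * α / n, ⟨p, h, fun _ _ => Iff.rfl⟩,
        fun _ _ => Iff.rfl⟩
    · rintro ⟨B, ⟨q, hq, hB⟩, hp⟩
      rw [← hq]
      exact stepUpIndex_congr fun i k => (hp i k).trans (hB i k)
  rw [key]
  refine MeasurableSet.biUnion (Set.to_countable _) fun B _ => MeasurableSet.iInter fun i =>
    MeasurableSet.iInter fun k => ?_
  have h1 : MeasurableSet {p : Fin n → ℝ | p i ≤ ((k : ℕ) : ℝ) * α / n} :=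
    measurableSet_le (measurable_pi_apply i) measurable_const
  by_cases hB : B i k
  · simpa [hB] using h1
  · simpa only [hB, iff_false] using! h1.compl

lemma measurable_zeroed (α : ℝ) (i : Fin n) :
    Measurable (fun p : Fin n → ℝ => stepUpIndexZeroed α p i) :=
  (measurable_stepUpIndex α).comp measurable_update_left

lemma measurable_fdp (hα : 0 ≤ α) (I₀ : Finset (Fin n)) :
    Measurable (fun p : Fin n → ℝ => fdp α I₀ p) := by
  simp_rw [fdp_eq_sum hα]
  have h : ∀ i, Measurable (fun p : Fin n → ℝ => (stepUpIndexZeroed α p i : ℝ)) :=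
    fun i => measurable_from_top.comp (measurable_zeroed α i)
  refine Finset.measurable_sum _ fun i _ => Measurable.ite ?_ (h i).inv measurable_const
  exact measurableSet_le (measurable_pi_apply i) (((h i).mul_const α).div_const _)

end StepUp

/-! ### Independent p-values -/

section Resampling

variable {ι : Type*} [Fintype ι] [DecidableEq ι] {μ : Measure ℝ} [IsProbabilityMeasure μ]

/-- Resampling one coordinate independently preserves the product law. This allows integrating out
the `i`-th p-value while keeping the index type, so that the leave-one-out index stays constant in
the inner integral. -/
lemma measurePreserving_update_pi (i : ι) :
    MeasurePreserving (fun z : (ι → ℝ) × ℝ => Function.update z.1 i z.2)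
      ((Measure.pi fun _ : ι => μ).prod μ) (Measure.pi fun _ : ι => μ) := by
  refine ⟨measurable_update', (Measure.pi_eq fun s hs => ?_).symm⟩
  rw [Measure.map_apply measurable_update' (MeasurableSet.univ_pi hs)]
  have h : (fun z : (ι → ℝ) × ℝ => Function.update z.1 i z.2) ⁻¹' Set.univ.pi s =
      (Set.univ.pi (Function.update s i Set.univ)) ×ˢ s i := by
    ext ⟨y, a⟩
    simp only [Set.mem_preimage, Set.mem_pi, Set.mem_univ, true_imp_iff, Set.mem_prod]
    constructor
    · refine fun h => ⟨fun j => ?_, by simpa using h i⟩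
      by_cases hj : j = i
      · subst hj; simp
      · simpa [hj] using h j
    · rintro ⟨h1, h2⟩ j
      by_cases hj : j = i
      · subst hj; simpa using h2
      · simpa [hj] using h1 j
  rw [h, Measure.prod_prod, Measure.pi_pi, ← Finset.prod_erase_mul _ _ (Finset.mem_univ i),
    ← Finset.prod_erase_mul (f := fun i => μ (s i)) _ (Finset.mem_univ i)]
  simp only [Function.update_self, measure_univ, mul_one]
  congr 1
  refine Finset.prod_congr rfl fun j hj => ?_
  rw [Function.update_of_ne (Finset.ne_of_mem_erase hj)]

lemma integral_pi_eq_integral_update (i : ι) {G : (ι → ℝ) → ℝ}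
    (hG : Integrable G (Measure.pi fun _ : ι => μ)) :
    ∫ y, G y ∂(Measure.pi fun _ : ι => μ) =
      ∫ y, ∫ a, G (Function.update y i a) ∂μ ∂(Measure.pi fun _ : ι => μ) := by
  have h := measurePreserving_update_pi (μ := μ) i
  conv_lhs => rw [← h.map_eq]
  rw [integral_map h.measurable.aemeasurable (by rw [h.map_eq]; exact hG.aestronglyMeasurable)]
  exact integral_prod _ (h.integrable_comp_of_integrable hG)

end Resampling

section NullPValues

variable {n : ℕ} {α : ℝ} {μ : Measure ℝ} [IsProbabilityMeasure μ] {q : ℝ → ℝ} {I₀ : Finset (Fin n)}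

/-- The p-values that are given by `q (y i)` for the true hypotheses and by `0` for the others. -/
def nullPValue (q : ℝ → ℝ) (I₀ : Finset (Fin n)) (y : Fin n → ℝ) (i : Fin n) : ℝ :=
  if i ∈ I₀ then q (y i) else 0

lemma measurable_nullPValue (hq : Measurable q) : Measurable (nullPValue q I₀) := by
  refine measurable_pi_iff.2 fun i => ?_
  unfold nullPValue
  split_ifs
  · exact hq.comp (measurable_pi_apply i)
  · exact measurable_const

lemma cdf_map_eq (hq : Measurable q) (t : ℝ) : cdf (μ.map q) t = μ.real {y | q y ≤ t} := by
  have := Measure.isProbabilityMeasure_map (μ := μ) hq.aemeasurable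
  rw [cdf_eq_real, map_measureReal_apply hq measurableSet_Iic]
  rfl

lemma zeroed_update (i : Fin n) (y : Fin n → ℝ) (a : ℝ) :
    stepUpIndexZeroed α (nullPValue q I₀ (Function.update y i a)) i =
      stepUpIndexZeroed α (nullPValue q I₀ y) i := by
  unfold stepUpIndexZeroed
  congr 1
  ext j
  by_cases h : j = i
  · subst h; simp
  · simp [nullPValue, h]

lemma integrable_of_abs_le {Ω : Type*} [MeasurableSpace Ω] {P : Measure Ω} [IsFiniteMeasure P]
    {f : Ω → ℝ} (hf : Measurable f) {C : ℝ} (h : ∀ ω, |f ω| ≤ C) : Integrable f P :=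
  Integrable.of_bound hf.aestronglyMeasurable C (Eventually.of_forall h)

/-- The false discovery rate as a sum over the true hypotheses: given the other p-values, the
`i`-th p-value only has to be compared with the leave-one-out threshold. -/
lemma integral_fdp_eq (hα : 0 ≤ α) (hq : Measurable q) :
    ∫ y, fdp α I₀ (nullPValue q I₀ y) ∂(Measure.pi fun _ => μ) =
      ∑ i ∈ I₀, ∫ y, cdf (μ.map q) ((stepUpIndexZeroed α (nullPValue q I₀ y) i : ℝ) * α / n) *
        (stepUpIndexZeroed α (nullPValue q I₀ y) i : ℝ)⁻¹ ∂(Measure.pi fun _ => μ) := by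
  have hm : ∀ i, Measurable fun y => (stepUpIndexZeroed α (nullPValue q I₀ y) i : ℝ) :=
    fun i => measurable_from_top.comp ((measurable_zeroed α i).comp (measurable_nullPValue hq))
  have hint : ∀ i, Integrable (fun y =>
      if nullPValue q I₀ y i ≤ (stepUpIndexZeroed α (nullPValue q I₀ y) i : ℝ) * α / n
      then (stepUpIndexZeroed α (nullPValue q I₀ y) i : ℝ)⁻¹ else 0)
      (Measure.pi fun _ => μ) := by
    intro i
    refine integrable_of_abs_le (C := 1) (Measurable.ite ?_ (hm i).inv measurable_const) ?_
    · exact measurableSet_le ((measurable_pi_apply i).comp (measurable_nullPValue hq))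
        (((hm i).mul_const α).div_const _)
    · intro y
      have h1 : (1 : ℝ) ≤ stepUpIndexZeroed α (nullPValue q I₀ y) i := by
        exact_mod_cast one_le_zeroed hα i
      split_ifs
      · rw [abs_of_nonneg (by positivity)]; exact inv_le_one_of_one_le₀ h1
      · simp
  simp_rw [fdp_eq_sum hα]
  rw [integral_finsetSum _ fun i _ => hint i]
  refine Finset.sum_congr rfl fun i hi => ?_
  rw [integral_pi_eq_integral_update i (hint i)]
  refine integral_congr_ae (Eventually.of_forall fun y => ?_)
  simp only [zeroed_update]
  set m := stepUpIndexZeroed α (nullPValue q I₀ y) i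
  have h : (fun a => if nullPValue q I₀ (Function.update y i a) i ≤ (m : ℝ) * α / n
      then (m : ℝ)⁻¹ else 0) =
      Set.indicator {a | q a ≤ (m : ℝ) * α / n} (fun _ => (m : ℝ)⁻¹) := by
    ext a
    simp [nullPValue, hi, Set.indicator]
  rw [h, integral_indicator_const _ (measurableSet_le hq measurable_const), cdf_map_eq hq,
    smul_eq_mul]

/-- The number of true hypotheses whose p-value is at most `t`. -/
def nullCount (q : ℝ → ℝ) (I₀ : Finset (Fin n)) (t : ℝ) (y : Fin n → ℝ) : ℕ :=
  (I₀.filter fun i => q (y i) ≤ t).card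

lemma nullCount_mono {s t : ℝ} (h : s ≤ t) (y : Fin n → ℝ) :
    nullCount q I₀ s y ≤ nullCount q I₀ t y :=
  Finset.card_le_card (Finset.monotone_filter_right _ fun _ _ hi => le_trans hi h)

/-- Chebyshev's inequality for the number of small p-values. -/
lemma measure_nullCount_deviation_le (hq : Measurable q) (t : ℝ) {ε : ℝ} (hε : 0 < ε)
    (hn : 0 < n) :
    (Measure.pi fun _ : Fin n => μ).real
      {y | ε * n ≤ |(nullCount q I₀ t y : ℝ) - I₀.card * cdf (μ.map q) t|} ≤
      1 / (ε ^ 2 * n) := by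
  set X : Fin n → ℝ → ℝ := fun i => if i ∈ I₀ then Set.indicator {a | q a ≤ t} 1 else 0 with hX
  have hs : MeasurableSet {a | q a ≤ t} := measurableSet_le hq measurable_const
  have hXm : ∀ i, Measurable (X i) := by
    intro i
    simp only [hX]
    split_ifs
    · exact measurable_one.indicator hs
    · exact measurable_zero
  have hX01 : ∀ i a, X i a ∈ Set.Icc (0 : ℝ) 1 := by
    intro i a
    simp only [hX]
    split_ifs
    · by_cases h : q a ≤ t <;> simp [Set.indicator, h]
    · simp
  have hL : ∀ i, MemLp (X i) 2 μ := fun i =>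
    MemLp.of_bound (hXm i).aestronglyMeasurable 1 (Eventually.of_forall fun a => by
      rw [Real.norm_eq_abs, abs_of_nonneg (hX01 i a).1]; exact (hX01 i a).2)
  have hvar := variance_sum_pi (μ := fun _ : Fin n => μ) hL
  have hvar_le : Var[∑ i, fun ω : Fin n → ℝ => X i (ω i); Measure.pi fun _ => μ] ≤ n := by
    rw [hvar]
    calc ∑ i, Var[X i; μ] ≤ ∑ _i : Fin n, (1 : ℝ) := Finset.sum_le_sum fun i _ =>
          (variance_le_sq_of_bounded (Eventually.of_forall (hX01 i)) (hXm i).aemeasurable).trans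
            (by norm_num)
      _ = n := by simp
  have hcount : ∀ y, (∑ i, fun ω : Fin n → ℝ => X i (ω i)) y = nullCount q I₀ t y := by
    intro y
    rw [Finset.sum_apply, nullCount, Finset.card_filter, Nat.cast_sum,
      ← Finset.sum_filter_add_sum_filter_not Finset.univ (· ∈ I₀)]
    have h2 : ∑ i ∈ Finset.univ.filter (· ∉ I₀), X i (y i) = 0 :=
      Finset.sum_eq_zero fun i hi => by simp [hX, (Finset.mem_filter.1 hi).2]
    rw [h2, add_zero, Finset.filter_univ_mem]
    exact Finset.sum_congr rfl fun i hi => by simp [hX, hi, Set.indicator]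
  have hmean : ∫ y, (∑ i, fun ω : Fin n → ℝ => X i (ω i)) y ∂(Measure.pi fun _ => μ) =
      I₀.card * cdf (μ.map q) t := by
    simp only [Finset.sum_apply]
    have hi2 : ∀ i, Integrable (fun ω : Fin n → ℝ => X i (ω i)) (Measure.pi fun _ => μ) :=
      fun i => integrable_of_abs_le (C := 1) ((hXm i).comp (measurable_pi_apply i)) fun y => by
        rw [abs_of_nonneg (hX01 i _).1]; exact (hX01 i _).2
    rw [integral_finsetSum _ fun i _ => hi2 i]
    have : ∀ i, ∫ ω : Fin n → ℝ, X i (ω i) ∂(Measure.pi fun _ => μ) =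
        if i ∈ I₀ then cdf (μ.map q) t else 0 := by
      intro i
      rw [integral_comp_eval (μ := fun _ : Fin n => μ) (hXm i).aestronglyMeasurable]
      simp only [hX]
      split_ifs
      · rw [integral_indicator_one hs, cdf_map_eq hq]
      · simp
    simp [this]
  have hLsum : MemLp (∑ i, fun ω : Fin n → ℝ => X i (ω i)) 2 (Measure.pi fun _ => μ) :=
    memLp_finsetSum' _ fun i _ => (hL i).comp_measurePreserving (measurePreserving_eval _ i)
  have hnR : (0 : ℝ) < n := by exact_mod_cast hn
  have hch := meas_ge_le_variance_div_sq hLsum (c := ε * n) (by positivity)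
  rw [hmean] at hch
  simp only [hcount] at hch
  have h3 := ENNReal.toReal_mono ENNReal.ofReal_ne_top hch
  rw [ENNReal.toReal_ofReal (div_nonneg (variance_nonneg _ _) (sq_nonneg _))] at h3
  refine h3.trans ?_
  calc _ ≤ (n : ℝ) / (ε * n) ^ 2 := by gcongr
    _ = 1 / (ε ^ 2 * n) := by field_simp

end NullPValues

/-! ### Asymptotics for independent and identically distributed null p-values -/

section Asymptotics

variable {α : ℝ} {μ : Measure ℝ} [IsProbabilityMeasure μ] {q : ℝ → ℝ} {I₀ : ∀ n : ℕ, Finset (Fin n)}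

lemma measurable_nullCount {n : ℕ} (hq : Measurable q) (I₀ : Finset (Fin n)) (t : ℝ) :
    Measurable fun y => (nullCount q I₀ t y : ℝ) := by
  simp only [nullCount, Finset.card_filter, Nat.cast_sum]
  refine Finset.measurable_sum _ fun i _ => ?_
  refine measurable_from_top.comp (Measurable.ite ?_ measurable_const measurable_const)
  exact measurableSet_le (hq.comp (measurable_pi_apply i)) measurable_const

lemma card_le_natCast {n : ℕ} (I₀ : Finset (Fin n)) : (I₀.card : ℝ) ≤ n := by
  exact_mod_cast (by simpa using! Finset.card_le_univ I₀)

lemma countLE_nullPValue_le {n : ℕ} (I₀ : Finset (Fin n)) (t : ℝ) (y : Fin n → ℝ) :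
    (countLE (nullPValue q I₀ y) t : ℝ) ≤ nullCount q I₀ t y + ((n : ℝ) - I₀.card) := by
  have h : countLE (nullPValue q I₀ y) t ≤ nullCount q I₀ t y + I₀ᶜ.card := by
    refine (Finset.card_le_card (t := (I₀.filter fun i => q (y i) ≤ t) ∪ I₀ᶜ) fun i hi => ?_).trans
      (Finset.card_union_le _ _)
    have hi' := (Finset.mem_filter.1 hi).2
    by_cases hI : i ∈ I₀
    · simp only [nullPValue, hI, if_true] at hi'
      simp [hI, hi']
    · simp [hI]
  have h3 : I₀.card + I₀ᶜ.card = n := by simp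
  have h' : (countLE (nullPValue q I₀ y) t : ℝ) ≤ nullCount q I₀ t y + I₀ᶜ.card := by
    exact_mod_cast h
  have h3' : (I₀.card : ℝ) + I₀ᶜ.card = n := by exact_mod_cast h3
  linarith

lemma nullCount_le_countLE {n : ℕ} (I₀ : Finset (Fin n)) (t : ℝ) (y : Fin n → ℝ) :
    nullCount q I₀ t y ≤ countLE (nullPValue q I₀ y) t := by
  refine Finset.card_le_card fun i hi => ?_
  obtain ⟨h1, h2⟩ := Finset.mem_filter.1 hi
  refine Finset.mem_filter.2 ⟨Finset.mem_univ _, ?_⟩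
  simpa [nullPValue, h1] using h2

lemma tendsto_deviation_bound {ε : ℝ} (hε : 0 < ε) :
    Tendsto (fun n : ℕ => 1 / (ε ^ 2 * n)) atTop (𝓝 0) :=
  tendsto_const_nhds.div_atTop (tendsto_natCast_atTop_atTop.const_mul_atTop (by positivity))

lemma tendsto_measure_nullCount_ge (hq : Measurable q) {t b : ℝ} (hb : cdf (μ.map q) t < b) :
    Tendsto (fun n : ℕ => (Measure.pi fun _ : Fin n => μ).real
      {y | b * n ≤ nullCount q (I₀ n) t y}) atTop (𝓝 0) := by
  refine squeeze_zero' (Eventually.of_forall fun n => measureReal_nonneg) ?_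
    (tendsto_deviation_bound (sub_pos.2 hb))
  filter_upwards [eventually_gt_atTop 0] with n hn
  refine (measureReal_mono fun y hy => ?_).trans
    (measure_nullCount_deviation_le (I₀ := I₀ n) hq t (sub_pos.2 hb) hn)
  have h1 : b * n ≤ nullCount q (I₀ n) t y := hy
  have h2 := mul_le_mul_of_nonneg_right (card_le_natCast (I₀ n)) (cdf_nonneg (μ.map q) t)
  change _ ≤ |(_ : ℝ)|
  refine le_trans ?_ (le_abs_self _)
  linarith

lemma tendsto_measure_nullCount_lt (hq : Measurable q)
    (hζ : Tendsto (fun n : ℕ => ((I₀ n).card : ℝ) / (n : ℝ)) atTop (𝓝 1))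
    {t b : ℝ} (hb : b < cdf (μ.map q) t) :
    Tendsto (fun n : ℕ => (Measure.pi fun _ : Fin n => μ).real
      {y | nullCount q (I₀ n) t y < b * n}) atTop (𝓝 0) := by
  -- Half of the gap absorbs `ζ_n < 1`, the other half is left for Chebyshev's inequality.
  have hε : 0 < (cdf (μ.map q) t - b) / 2 := by linarith
  refine squeeze_zero' (Eventually.of_forall fun n => measureReal_nonneg) ?_
    (tendsto_deviation_bound hε)
  have hev : ∀ᶠ n : ℕ in atTop,
      (cdf (μ.map q) t + b) / 2 < ((I₀ n).card : ℝ) / n * cdf (μ.map q) t :=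
    (hζ.mul_const _).eventually (lt_mem_nhds (by linarith))
  filter_upwards [eventually_gt_atTop 0, hev] with n hn h
  have hnR : (0 : ℝ) < n := by exact_mod_cast hn
  refine (measureReal_mono fun y hy => ?_).trans
    (measure_nullCount_deviation_le (I₀ := I₀ n) hq t hε hn)
  have h1 : (nullCount q (I₀ n) t y : ℝ) < b * n := hy
  rw [div_mul_eq_mul_div, lt_div_iff₀ hnR] at h
  change _ ≤ |(_ : ℝ)|
  refine le_trans ?_ (neg_le_abs _)
  linarith

/-- If the distribution function of the null p-values exceeds the Simes line `t / α` somewhere,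
then the false discovery rate tends to one. -/
lemma tendsto_fdr_one (hα : 0 < α) (hq : Measurable q)
    (hζ : Tendsto (fun n : ℕ => ((I₀ n).card : ℝ) / (n : ℝ)) atTop (𝓝 1))
    {t : ℝ} (ht : 0 < t) (hF : t / α < cdf (μ.map q) t) :
    Tendsto (fun n : ℕ => ∫ y, fdp α (I₀ n) (nullPValue q (I₀ n) y) ∂(Measure.pi fun _ => μ))
      atTop (𝓝 1) := by
  obtain ⟨b, hb1, hb2⟩ := exists_between hF
  have hlim : Tendsto (fun n : ℕ => 1 - (1 - ((I₀ n).card : ℝ) / n) * (α / t) -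
      (Measure.pi fun _ : Fin n => μ).real {y | nullCount q (I₀ n) t y < b * n}) atTop (𝓝 1) := by
    have := ((((hζ.const_sub 1).mul_const (α / t)).const_sub 1).sub
      (tendsto_measure_nullCount_lt hq hζ hb2))
    simpa using this
  have hint : ∀ n, Integrable (fun y => fdp α (I₀ n) (nullPValue q (I₀ n) y))
      (Measure.pi fun _ => μ) := fun n =>
    integrable_of_abs_le ((measurable_fdp hα.le _).comp (measurable_nullPValue hq)) (C := 1)
      fun y => by rw [abs_of_nonneg (fdp_nonneg _)]; exact fdp_le_one _
  refine tendsto_of_tendsto_of_tendsto_of_le_of_le' hlim tendsto_const_nhds ?_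
    (Eventually.of_forall fun n => ?_)
  -- Room for rounding: `⌈nt/α⌉`, the first index whose critical value reaches `t`, must not exceed
  -- `b n`.
  · have hev : ∀ᶠ n : ℕ in atTop, 1 ≤ (b - t / α) * n :=
      (tendsto_natCast_atTop_atTop.const_mul_atTop (sub_pos.2 hb1)).eventually_ge_atTop 1
    filter_upwards [eventually_gt_atTop 0, hev] with n hn h1n
    have hnR : (0 : ℝ) < n := by exact_mod_cast hn
    set E : Set (Fin n → ℝ) := {y | nullCount q (I₀ n) t y < b * n}
    have hE : MeasurableSet E := measurableSet_lt (measurable_nullCount hq _ _) measurable_const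
    have hEi : Integrable (E.indicator (fun _ => (1 : ℝ))) (Measure.pi fun _ => μ) :=
      (integrable_const 1).indicator hE
    set K : ℝ := 1 - (1 - ((I₀ n).card : ℝ) / n) * (α / t)
    have hK : K ≤ 1 := by
      have : ((I₀ n).card : ℝ) / n ≤ 1 := div_le_one_of_le₀ (card_le_natCast _) hnR.le
      have h2 : 0 ≤ (1 - ((I₀ n).card : ℝ) / n) * (α / t) :=
        mul_nonneg (by linarith) (by positivity)
      linarith
    calc K - (Measure.pi fun _ : Fin n => μ).real E
        = ∫ y, (K - E.indicator (fun _ => (1 : ℝ)) y) ∂(Measure.pi fun _ => μ) := by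
          rw [integral_sub (integrable_const _) hEi, integral_indicator_const _ hE]
          simp
      _ ≤ _ := integral_mono ((integrable_const _).sub hEi) (hint n) fun y => ?_
    by_cases hy : y ∈ E
    · have := fdp_nonneg (α := α) (p := nullPValue q (I₀ n) y) (I₀ n)
      simp only [Set.indicator_of_mem hy]
      linarith
    · simp only [Set.indicator_of_notMem hy, sub_zero]
      have hy' : b * n ≤ nullCount q (I₀ n) t y := not_lt.1 hy
      have hc : (0 : ℝ) < n * t / α := by positivity
      have hk : ⌈(n : ℝ) * t / α⌉₊ ≤ nullCount q (I₀ n) t y := by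
        have h3 := Nat.ceil_lt_add_one hc.le
        have h4 : (b - t / α) * n = b * n - n * t / α := by ring
        have : (⌈(n : ℝ) * t / α⌉₊ : ℝ) ≤ nullCount q (I₀ n) t y := by linarith
        exact_mod_cast this
      have hkt : t ≤ (⌈(n : ℝ) * t / α⌉₊ : ℝ) * α / n := by
        rw [le_div_iff₀ hnR, ← div_le_iff₀ hα, mul_comm t]
        exact Nat.le_ceil _
      have hkm : ⌈(n : ℝ) * t / α⌉₊ ≤ stepUpIndex α (nullPValue q (I₀ n) y) :=
        le_stepUpIndex ((hk.trans (nullCount_le_countLE _ _ _)).trans (countLE_mono hkt))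
      have h5 : (n : ℝ) * t / α ≤ stepUpIndex α (nullPValue q (I₀ n) y) :=
        (Nat.le_ceil _).trans (by exact_mod_cast hkm)
      refine le_trans (le_of_eq ?_) (one_sub_le_fdp hα.le (I₀ n) hc h5)
      simp only [K]
      field_simp
  · calc _ ≤ ∫ _y, (1 : ℝ) ∂(Measure.pi fun _ : Fin n => μ) :=
          integral_mono (hint n) (integrable_const _) fun y => fdp_le_one _
      _ = 1 := by simp

/-- If the distribution function of the null p-values stays strictly below the Simes line on the
compact set `S`, then with high probability the empirical distribution function does so, too. -/
lemma tendsto_measure_exists_crossing (hα : 0 < α) (hq : Measurable q)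
    (hζ : Tendsto (fun n : ℕ => ((I₀ n).card : ℝ) / (n : ℝ)) atTop (𝓝 1))
    {S : Set ℝ} (hS : IsCompact S) (hF : ∀ t ∈ S, cdf (μ.map q) t < t / α) :
    Tendsto (fun n : ℕ => (Measure.pi fun _ : Fin n => μ).real
      {y | ∃ t ∈ S, n * t / α ≤ nullCount q (I₀ n) t y + ((n : ℝ) - (I₀ n).card) + 1})
      atTop (𝓝 0) := by
  refine hS.induction_on (p := fun S => Tendsto (fun n : ℕ =>
    (Measure.pi fun _ : Fin n => μ).real {y | ∃ t ∈ S,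
      n * t / α ≤ nullCount q (I₀ n) t y + ((n : ℝ) - (I₀ n).card) + 1}) atTop (𝓝 0)) ?_ ?_ ?_ ?_
  · simp
  · intro S T hST hT
    refine squeeze_zero (fun n => measureReal_nonneg) (fun n => measureReal_mono ?_) hT
    rintro y ⟨t, ht, h⟩
    exact ⟨t, hST ht, h⟩
  · intro S T hS hT
    refine squeeze_zero (fun n => measureReal_nonneg) (fun n => ?_) (by simpa using hS.add hT)
    refine le_trans (measureReal_mono ?_) (measureReal_union_le _ _)
    rintro y ⟨t, ht | ht, h⟩
    · exact Or.inl ⟨t, ht, h⟩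
    · exact Or.inr ⟨t, ht, h⟩
  · intro t ht
    obtain ⟨r', hr1, hr2⟩ := exists_between (hF t ht)
    set r := r' * α
    have hrt : r < t := (lt_div_iff₀ hα).1 hr2
    have hr1 : cdf (μ.map q) t < r / α := by simpa [r, hα.ne'] using hr1
    have hright : Tendsto (cdf (μ.map q)) (𝓝[>] t) (𝓝 (cdf (μ.map q) t)) :=
      ((cdf (μ.map q)).right_continuous t).tendsto.mono_left
        (nhdsWithin_mono _ Set.Ioi_subset_Ici_self)
    obtain ⟨s, hs, hts⟩ := ((hright.eventually (gt_mem_nhds hr1)).and self_mem_nhdsWithin).exists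
    obtain ⟨b, hb1, hb2⟩ := exists_between hs
    -- On `(r, s)` monotonicity reduces all `u` to one event: the count at `u` is at most that at
    -- `s`, the line at `u` at least that at `r`. Right continuity of the distribution function
    -- suffices to find `s`.
    refine ⟨Set.Ioo r s, mem_nhdsWithin_of_mem_nhds (Ioo_mem_nhds hrt hts), ?_⟩
    refine squeeze_zero' (Eventually.of_forall fun n => measureReal_nonneg) ?_
      (tendsto_measure_nullCount_ge (I₀ := I₀) hq hb1)
    have hlim : Tendsto (fun n : ℕ => r / α - (1 - ((I₀ n).card : ℝ) / n) - 1 / (n : ℝ))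
        atTop (𝓝 (r / α)) := by
      simpa using ((hζ.const_sub 1).const_sub (r / α)).sub tendsto_one_div_atTop_nhds_zero_nat
    filter_upwards [eventually_gt_atTop 0, hlim.eventually (lt_mem_nhds hb2)] with n hn hbn
    have hnR : (0 : ℝ) < n := by exact_mod_cast hn
    refine measureReal_mono ?_
    rintro y ⟨u, hu, h⟩
    change _ ≤ (_ : ℝ)
    have h1 : (nullCount q (I₀ n) u y : ℝ) ≤ nullCount q (I₀ n) s y := by
      exact_mod_cast nullCount_mono hu.2.le y
    have h2 : (n : ℝ) * r / α ≤ n * u / α := by gcongr; exact hu.1.le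
    have h3 := mul_le_mul_of_nonneg_right hbn.le hnR.le
    have h4 : (r / α - (1 - ((I₀ n).card : ℝ) / n) - 1 / (n : ℝ)) * n =
        n * r / α - (n - (I₀ n).card) - 1 := by field_simp
    linarith

/-- If the distribution function of the null p-values stays strictly below the Simes line `t / α`
and has derivative zero at zero, then the false discovery rate tends to zero. -/
lemma tendsto_fdr_zero (hα : 0 < α) (hq : Measurable q)
    (hζ : Tendsto (fun n : ℕ => ((I₀ n).card : ℝ) / (n : ℝ)) atTop (𝓝 1))
    (hF : ∀ t, 0 < t → t ≤ α → cdf (μ.map q) t < t / α)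
    (hF0 : Tendsto (fun t => cdf (μ.map q) t / t) (𝓝[>] 0) (𝓝 0)) :
    Tendsto (fun n : ℕ => ∫ y, fdp α (I₀ n) (nullPValue q (I₀ n) y) ∂(Measure.pi fun _ => μ))
      atTop (𝓝 0) := by
  set F := cdf (μ.map q)
  have key : ∀ ε > 0, ∀ᶠ n : ℕ in atTop,
      ∫ y, fdp α (I₀ n) (nullPValue q (I₀ n) y) ∂(Measure.pi fun _ => μ) ≤ ε * α + ε := by
    intro ε hε
    obtain ⟨δ, hδ0, hδ⟩ := mem_nhdsGT_iff_exists_Ioo_subset.1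
      (hF0.eventually (gt_mem_nhds hε))
    have hδ0 : 0 < δ := hδ0
    have hS := tendsto_measure_exists_crossing (S := Set.Icc δ α) hα hq hζ isCompact_Icc
      fun t ht => hF t (hδ0.trans_le ht.1) ht.2
    filter_upwards [eventually_gt_atTop 0, hS.eventually (gt_mem_nhds hε)] with n hn hD
    have hnR : (0 : ℝ) < n := by exact_mod_cast hn
    set D : Set (Fin n → ℝ) := {y | ∃ t ∈ Set.Icc δ α,
      n * t / α ≤ nullCount q (I₀ n) t y + ((n : ℝ) - (I₀ n).card) + 1}
    -- `D` is an uncountable union over `t`; its measurable hull has the same measure and spares a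
    -- proof of measurability.
    set D' := toMeasurable (Measure.pi fun _ : Fin n => μ) D
    have hD' : MeasurableSet D' := measurableSet_toMeasurable _ _
    have hDD : (Measure.pi fun _ : Fin n => μ).real D' =
        (Measure.pi fun _ : Fin n => μ).real D := by
      simp only [Measure.real, D', measure_toMeasurable]
    have hterm : ∀ i ∈ I₀ n, ∫ y, F ((stepUpIndexZeroed α (nullPValue q (I₀ n) y) i : ℝ) * α / n) *
        (stepUpIndexZeroed α (nullPValue q (I₀ n) y) i : ℝ)⁻¹ ∂(Measure.pi fun _ => μ) ≤
        (ε * α + ε) / n := by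
      intro i _
      have hi : Integrable (D'.indicator fun _ => (n : ℝ)⁻¹) (Measure.pi fun _ => μ) :=
        (integrable_const _).indicator hD'
      calc _ ≤ ∫ y, (ε * α / n + D'.indicator (fun _ => (n : ℝ)⁻¹) y) ∂(Measure.pi fun _ => μ) := by
            refine integral_mono_of_nonneg (Eventually.of_forall fun y => ?_)
              ((integrable_const _).add hi) (Eventually.of_forall fun y => ?_)
            · exact mul_nonneg (cdf_nonneg _ _) (by positivity)
            simp only
            set m := stepUpIndexZeroed α (nullPValue q (I₀ n) y) i with hm
            have hm1 : (0 : ℝ) < m := by exact_mod_cast one_le_zeroed hα.le i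
            have hmn : (m : ℝ) ≤ n := by exact_mod_cast stepUpIndex_le
            have hτ0 : 0 < (m : ℝ) * α / n := by positivity
            have hτα : (m : ℝ) * α / n ≤ α := by
              rw [div_le_iff₀ hnR, mul_comm α]; gcongr
            -- Below `δ` the flatness of `F` at zero bounds the integrand by `εα/n`. Otherwise `y`
            -- lies in the rare event `D`, and `F(t) ≤ t/α` still gives `1/n`.
            by_cases hτ : (m : ℝ) * α / n < δ
            · have h1 : F ((m : ℝ) * α / n) / ((m : ℝ) * α / n) < ε := hδ ⟨hτ0, hτ⟩
              rw [div_lt_iff₀ hτ0] at h1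
              have h2 : 0 ≤ D'.indicator (fun _ => (n : ℝ)⁻¹) y :=
                Set.indicator_nonneg (fun _ _ => by positivity) _
              calc F ((m : ℝ) * α / n) * (m : ℝ)⁻¹
                  ≤ ε * ((m : ℝ) * α / n) * (m : ℝ)⁻¹ := by gcongr
                _ = ε * α / n := by field_simp
                _ ≤ _ := by linarith
            · have hy : y ∈ D := by
                refine ⟨(m : ℝ) * α / n, ⟨not_lt.1 hτ, hτα⟩, ?_⟩
                -- The slack in `D` is used here: the zeroed p-value adds at most `1` to the count,
                -- the false hypotheses at most `n - |I₀|`.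
                have h1 := stepUpIndex_le_countLE (Function.update (nullPValue q (I₀ n) y) i 0) α
                have h2 := h1.trans (countLE_update_le i)
                have h3 : (m : ℝ) ≤ countLE (nullPValue q (I₀ n) y) ((m : ℝ) * α / n) + 1 := by
                  exact_mod_cast h2
                have h4 := countLE_nullPValue_le (q := q) (I₀ n) ((m : ℝ) * α / n) y
                have h5 : (n : ℝ) * ((m : ℝ) * α / n) / α = m := by field_simp
                rw [h5]
                linarith
              rw [Set.indicator_of_mem (subset_toMeasurable _ _ hy)]
              have h1 := (hF _ hτ0 hτα).le
              calc F ((m : ℝ) * α / n) * (m : ℝ)⁻¹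
                  ≤ ((m : ℝ) * α / n / α) * (m : ℝ)⁻¹ := by gcongr
                _ = (n : ℝ)⁻¹ := by field_simp
                _ ≤ _ := by
                  have : 0 ≤ ε * α / n := by positivity
                  linarith
        _ = ε * α / n + (Measure.pi fun _ : Fin n => μ).real D * (n : ℝ)⁻¹ := by
            rw [integral_add (integrable_const _) hi, integral_indicator_const _ hD', hDD]
            simp
        _ ≤ (ε * α + ε) / n := by
            rw [add_div, div_eq_mul_inv ε]
            gcongr
    rw [integral_fdp_eq hα.le hq]
    calc _ ≤ ∑ _i ∈ I₀ n, (ε * α + ε) / n := Finset.sum_le_sum hterm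
      _ = (I₀ n).card * ((ε * α + ε) / n) := by simp
      _ ≤ n * ((ε * α + ε) / n) := by
        refine mul_le_mul_of_nonneg_right (card_le_natCast _) (by positivity)
      _ = ε * α + ε := by field_simp
  refine tendsto_order.2 ⟨fun a ha => Eventually.of_forall fun n => ha.trans_le
    (integral_nonneg fun y => fdp_nonneg _), fun a ha => ?_⟩
  filter_upwards [key (a / (2 * (α + 1))) (by positivity)] with n hn
  refine hn.trans_lt ?_
  have : a / (2 * (α + 1)) * α + a / (2 * (α + 1)) = a / 2 := by field_simp
  linarith

/-- If the null p-values are uniformly distributed, then the false discovery rate tends to `α`. -/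
lemma tendsto_fdr_of_uniform (hα : 0 < α) (hα1 : α < 1) (hq : Measurable q)
    (hζ : Tendsto (fun n : ℕ => ((I₀ n).card : ℝ) / (n : ℝ)) atTop (𝓝 1))
    (hF : ∀ t, 0 < t → t < 1 → cdf (μ.map q) t = t) :
    Tendsto (fun n : ℕ => ∫ y, fdp α (I₀ n) (nullPValue q (I₀ n) y) ∂(Measure.pi fun _ => μ))
      atTop (𝓝 α) := by
  have h1 : Tendsto (fun n : ℕ => ((I₀ n).card : ℝ) / n * α) atTop (𝓝 α) := by
    simpa using hζ.mul_const α
  refine h1.congr' ?_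
  filter_upwards [eventually_gt_atTop 0] with n hn
  have hnR : (0 : ℝ) < n := by exact_mod_cast hn
  rw [integral_fdp_eq hα.le hq]
  have : ∀ i ∈ I₀ n, ∫ y, cdf (μ.map q)
      ((stepUpIndexZeroed α (nullPValue q (I₀ n) y) i : ℝ) * α / n) *
        (stepUpIndexZeroed α (nullPValue q (I₀ n) y) i : ℝ)⁻¹ ∂(Measure.pi fun _ => μ) = α / n := by
    intro i _
    calc _ = ∫ _y, α / n ∂(Measure.pi fun _ : Fin n => μ) := by
          refine integral_congr_ae (Eventually.of_forall fun y => ?_)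
          simp only
          set m := stepUpIndexZeroed α (nullPValue q (I₀ n) y) i with hm
          have hm1 : (0 : ℝ) < m := by exact_mod_cast one_le_zeroed hα.le i
          have hmn : (m : ℝ) ≤ n := by exact_mod_cast stepUpIndex_le
          have hτα : (m : ℝ) * α / n ≤ α := by
            rw [div_le_iff₀ hnR, mul_comm α]; gcongr
          rw [hF _ (by positivity) (hτα.trans_lt hα1)]
          field_simp
      _ = α / n := by simp
  rw [Finset.sum_congr rfl this, Finset.sum_const, nsmul_eq_mul]
  ring

end Asymptotics

/-! ### The equi-correlated normal model -/

section Model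

variable {α ρ : ℝ}

/-- The p-value of a true hypothesis as a function of the common and of the individual normal
variable. -/
def modelPValue (ρ x y : ℝ) : ℝ := upperTail (√(1 - ρ) * y - √ρ * x)

/-- The individual normal variable exceeds `shifted ρ x u` iff the test statistic exceeds `u`. -/
def shifted (ρ x u : ℝ) : ℝ := (u + √ρ * x) / √(1 - ρ)

lemma measurable_modelPValue (ρ x : ℝ) : Measurable (modelPValue ρ x) :=
  continuous_upperTail.measurable.comp (by fun_prop)

lemma measurable_uncurry_modelPValue (ρ : ℝ) :
    Measurable (fun z : ℝ × ℝ => modelPValue ρ z.1 z.2) :=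
  continuous_upperTail.measurable.comp (by fun_prop)

lemma sqrt_one_sub_pos (hρ : ρ < 1) : 0 < √(1 - ρ) := Real.sqrt_pos.2 (by linarith)

lemma cdf_modelPValue (hρ : ρ < 1) (x u : ℝ) :
    cdf ((gaussianReal 0 1).map (modelPValue ρ x)) (upperTail u) = upperTail (shifted ρ x u) := by
  rw [cdf_map_eq (measurable_modelPValue ρ x), ← gaussianReal_real_Ici (shifted ρ x u)]
  congr 1
  ext y
  simp only [Set.mem_ofPred_eq, Set.mem_Ici, modelPValue, shifted]
  rw [strictAnti_upperTail.le_iff_ge, div_le_iff₀ (sqrt_one_sub_pos hρ)]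
  constructor <;> intro h <;> linarith

lemma measurable_uncurry_fdp (hα : 0 ≤ α) {n : ℕ} (I₀ : Finset (Fin n)) :
    Measurable (fun z : ℝ × (Fin n → ℝ) => fdp α I₀ (nullPValue (modelPValue ρ z.1) I₀ z.2)) := by
  refine (measurable_fdp hα I₀).comp (measurable_pi_iff.2 fun i => ?_)
  unfold nullPValue
  split_ifs
  · exact (measurable_uncurry_modelPValue ρ).comp
      (measurable_fst.prodMk ((measurable_pi_apply i).comp measurable_snd))
  · exact measurable_const

/-- The false discovery rate given the value `x` of the common normal variable. -/
def conditionalFDR (α ρ : ℝ) {n : ℕ} (I₀ : Finset (Fin n)) (x : ℝ) : ℝ :=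
  ∫ y, fdp α I₀ (nullPValue (modelPValue ρ x) I₀ y) ∂(Measure.pi fun _ => gaussianReal 0 1)

lemma FDR_eq_integral (hα : 0 ≤ α) {n : ℕ} (I₀ : Finset (Fin n)) {Ω : Type*} [MeasurableSpace Ω]
    {P : Measure Ω} [IsProbabilityMeasure P] {X : Fin (n + 1) → Ω → ℝ}
    (hX : ∀ j, HasLaw (X j) (gaussianReal 0 1) P) (hindep : iIndepFun X P) :
    FDR α ρ I₀ P X = ∫ x, conditionalFDR α ρ I₀ x ∂(gaussianReal 0 1) := by
  set G : ℝ × (Fin n → ℝ) → ℝ := fun z => fdp α I₀ (nullPValue (modelPValue ρ z.1) I₀ z.2)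
  have hG : Measurable G := measurable_uncurry_fdp hα I₀
  have hlaw := hindep.hasLaw_pi hX
  have hmp := measurePreserving_piFinSuccAbove (fun _ : Fin (n + 1) => gaussianReal 0 1) 0
  have hfdp : (fun x : Fin (n + 1) → ℝ => fdp α I₀ (pValue ρ I₀ x)) =
      fun x => G (MeasurableEquiv.piFinSuccAbove (fun _ => ℝ) 0 x) := by
    ext x
    rfl
  have hmeas : Measurable fun x : Fin (n + 1) → ℝ => fdp α I₀ (pValue ρ I₀ x) := by
    rw [hfdp]; exact hG.comp (MeasurableEquiv.measurable _)
  have h1 := hlaw.integral_comp (f := fun x => fdp α I₀ (pValue ρ I₀ x))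
    hmeas.aestronglyMeasurable
  have h2 : FDR α ρ I₀ P X = ∫ x, G (MeasurableEquiv.piFinSuccAbove (fun _ => ℝ) 0 x)
      ∂(Measure.pi fun _ : Fin (n + 1) => gaussianReal 0 1) := by
    rw [← hfdp, ← h1]; rfl
  rw [h2, hmp.integral_comp (MeasurableEquiv.measurableEmbedding _)]
  refine integral_prod G ?_
  exact integrable_of_abs_le hG (C := 1) fun z => by
    rw [abs_of_nonneg (fdp_nonneg _)]; exact fdp_le_one _

/-- The values of the common normal variable for which the conditional distribution function of
the p-values exceeds the Simes line. -/
def crossingSet (α ρ : ℝ) : Set ℝ := {x | ∃ u, upperTail u / α < upperTail (shifted ρ x u)}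

lemma shifted_lt_shifted (hρ0 : 0 < ρ) (hρ : ρ < 1) {x x' : ℝ} (h : x < x') (u : ℝ) :
    shifted ρ x u < shifted ρ x' u := by
  unfold shifted
  have := sqrt_one_sub_pos hρ
  have := Real.sqrt_pos.2 hρ0
  gcongr

lemma mem_crossingSet_of_lt (hρ0 : 0 < ρ) (hρ : ρ < 1) {x x' : ℝ} (h : x < x')
    (hx' : x' ∈ crossingSet α ρ) : x ∈ crossingSet α ρ := by
  obtain ⟨u, hu⟩ := hx'
  exact ⟨u, hu.trans (strictAnti_upperTail (shifted_lt_shifted hρ0 hρ h u))⟩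

lemma measurableSet_crossingSet (hρ0 : 0 < ρ) (hρ : ρ < 1) : MeasurableSet (crossingSet α ρ) := by
  have : IsLowerSet (crossingSet α ρ) := fun x' x h hx' => by
    rcases h.eq_or_lt with rfl | h
    · exact hx'
    · exact mem_crossingSet_of_lt hρ0 hρ h hx'
  exact this.ordConnected.measurableSet

/-- Since `√(1 - ρ) < 1`, the shifted point exceeds `u` by at least `1` for large `u`, and the Mills
bound makes the ratio at `t = upperTail u` at most `exp (-u)`. -/
lemma tendsto_cdf_modelPValue_div (hρ0 : 0 < ρ) (hρ : ρ < 1) (x : ℝ) :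
    Tendsto (fun t => cdf ((gaussianReal 0 1).map (modelPValue ρ x)) t / t) (𝓝[>] 0) (𝓝 0) := by
  have hr0 := sqrt_one_sub_pos hρ
  have hr1 : √(1 - ρ) < 1 := by
    rw [Real.sqrt_lt' one_pos]; linarith
  refine tendsto_order.2 ⟨fun a ha => ?_, fun ε hε => ?_⟩
  · filter_upwards [self_mem_nhdsWithin] with t ht
    have ht : (0 : ℝ) < t := ht
    exact ha.trans_le (div_nonneg (cdf_nonneg _ _) ht.le)
  have h1 : Tendsto (fun u : ℝ => u * ((1 - √(1 - ρ)) / √(1 - ρ)) + √ρ * x / √(1 - ρ))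
      atTop atTop :=
    tendsto_atTop_add_const_right _ _
      (tendsto_id.atTop_mul_const (div_pos (sub_pos.2 hr1) hr0))
  obtain ⟨M, hM⟩ := eventually_atTop.1 ((h1.eventually_ge_atTop 1).and
    ((Real.tendsto_exp_neg_atTop_nhds_zero.eventually (gt_mem_nhds hε)).and
      (eventually_ge_atTop 1)))
  filter_upwards [Ioo_mem_nhdsGT (upperTail_pos M)] with t ht
  obtain ⟨u, rfl⟩ := exists_upperTail_eq ht.1 (ht.2.trans (upperTail_lt_one M))
  have hMu : M < u := strictAnti_upperTail.lt_iff_gt.1 ht.2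
  obtain ⟨ha, hb, hc⟩ := hM u hMu.le
  rw [cdf_modelPValue hρ]
  have hv : 1 ≤ shifted ρ x u - u := by
    refine ha.trans_eq ?_
    unfold shifted
    field_simp
    ring
  have hlog := mul_sub_le_log_upperTail (v := u) (u := shifted ρ x u) (by linarith) (by linarith)
  refine lt_of_le_of_lt ?_ hb
  rw [← Real.log_le_iff_le_exp (div_pos (upperTail_pos _) (upperTail_pos _)),
    Real.log_div (upperTail_pos _).ne' (upperTail_pos _).ne']
  nlinarith

lemma tendsto_conditionalFDR (hα0 : 0 < α) (hα : α ≤ 1 / 2) (hρ0 : 0 < ρ) (hρ : ρ < 1)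
    {I₀ : ∀ n : ℕ, Finset (Fin n)}
    (hζ : Tendsto (fun n : ℕ => ((I₀ n).card : ℝ) / (n : ℝ)) atTop (𝓝 1)) :
    ∀ᵐ x ∂(gaussianReal 0 1), Tendsto (fun n : ℕ => conditionalFDR α ρ (I₀ n) x) atTop
      (𝓝 ((crossingSet α ρ).indicator (fun _ => (1 : ℝ)) x)) := by
  have := nullSingletonClass_gaussianReal (μ := 0) (v := 1) one_ne_zero
  set T : Set ℝ := {x | x ∉ crossingSet α ρ ∧
    ∃ u, upperTail u / α = upperTail (shifted ρ x u)}
  -- `T` consists of the tangential cases. Decreasing `x` strictly raises the distribution function,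
  -- so every point below one of touching is a crossing point.
  have hT : T.Subsingleton := by
    have aux : ∀ x ∈ T, ∀ x' ∈ T, ¬ x < x' := by
      rintro x ⟨hx, -⟩ x' ⟨-, u, hu⟩ h
      exact hx ⟨u, hu.trans_lt (strictAnti_upperTail (shifted_lt_shifted hρ0 hρ h u))⟩
    exact fun x hx x' hx' => le_antisymm (not_lt.1 (aux x' hx' x hx)) (not_lt.1 (aux x hx x' hx'))
  have hT0 : ∀ᵐ x ∂(gaussianReal 0 1), x ∉ T :=
    measure_eq_zero_iff_ae_notMem.1 (hT.measure_zero _)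
  filter_upwards [hT0] with x hx
  by_cases hA : x ∈ crossingSet α ρ
  · rw [Set.indicator_of_mem hA]
    obtain ⟨u, hu⟩ := hA
    refine tendsto_fdr_one hα0 (measurable_modelPValue ρ x) hζ (upperTail_pos u) ?_
    rwa [cdf_modelPValue hρ]
  · rw [Set.indicator_of_notMem hA]
    refine tendsto_fdr_zero hα0 (measurable_modelPValue ρ x) hζ (fun t ht0 htα => ?_)
      (tendsto_cdf_modelPValue_div hρ0 hρ x)
    obtain ⟨u, rfl⟩ := exists_upperTail_eq ht0 (by linarith)
    rw [cdf_modelPValue hρ]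
    refine lt_of_le_of_ne (not_lt.1 fun h => hA ⟨u, h⟩) fun h => hx ⟨hA, u, h.symm⟩

lemma conditionalFDR_nonneg {n : ℕ} (I₀ : Finset (Fin n)) (x : ℝ) :
    0 ≤ conditionalFDR α ρ I₀ x := integral_nonneg fun _ => fdp_nonneg _

lemma conditionalFDR_le_one (hα : 0 ≤ α) {n : ℕ} (I₀ : Finset (Fin n)) (x : ℝ) :
    conditionalFDR α ρ I₀ x ≤ 1 := by
  calc _ ≤ ∫ _y, (1 : ℝ) ∂(Measure.pi fun _ : Fin n => gaussianReal 0 1) :=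
        integral_mono (integrable_of_abs_le ((measurable_fdp hα _).comp
          (measurable_nullPValue (measurable_modelPValue ρ x))) (C := 1)
          fun y => (abs_of_nonneg (fdp_nonneg _)).trans_le (fdp_le_one _))
          (integrable_const _) fun y => fdp_le_one _
    _ = 1 := by simp

lemma tendsto_integral_conditionalFDR (hα0 : 0 < α) (hα : α ≤ 1 / 2) (hρ0 : 0 < ρ) (hρ : ρ < 1)
    {I₀ : ∀ n : ℕ, Finset (Fin n)}
    (hζ : Tendsto (fun n : ℕ => ((I₀ n).card : ℝ) / (n : ℝ)) atTop (𝓝 1)) :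
    Tendsto (fun n : ℕ => ∫ x, conditionalFDR α ρ (I₀ n) x ∂(gaussianReal 0 1)) atTop
      (𝓝 ((gaussianReal 0 1).real (crossingSet α ρ))) := by
  have h : (gaussianReal 0 1).real (crossingSet α ρ) =
      ∫ x, (crossingSet α ρ).indicator (fun _ => (1 : ℝ)) x ∂(gaussianReal 0 1) := by
    rw [integral_indicator_const _ (measurableSet_crossingSet hρ0 hρ)]
    simp
  rw [h]
  refine tendsto_integral_of_dominated_convergence (fun _ => 1) (fun n => ?_)
    (integrable_const _) (fun n => Eventually.of_forall fun x => ?_)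
    (tendsto_conditionalFDR hα0 hα hρ0 hρ hζ)
  · exact ((measurable_uncurry_fdp hα0.le (I₀ n)).stronglyMeasurable.integral_prod_right
      (ν := Measure.pi fun _ => gaussianReal 0 1)).aestronglyMeasurable
  · rw [Real.norm_eq_abs, abs_of_nonneg (conditionalFDR_nonneg _ _)]
    exact conditionalFDR_le_one hα0.le _ _

lemma conditionalFDR_zero {n : ℕ} (I₀ : Finset (Fin n)) (x : ℝ) :
    conditionalFDR α 0 I₀ x = conditionalFDR α 0 I₀ 0 := by
  have : modelPValue 0 x = modelPValue 0 0 := by ext y; simp [modelPValue]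
  rw [conditionalFDR, this, conditionalFDR]

lemma tendsto_integral_conditionalFDR_zero (hα0 : 0 < α) (hα : α ≤ 1 / 2)
    {I₀ : ∀ n : ℕ, Finset (Fin n)}
    (hζ : Tendsto (fun n : ℕ => ((I₀ n).card : ℝ) / (n : ℝ)) atTop (𝓝 1)) :
    Tendsto (fun n : ℕ => ∫ x, conditionalFDR α 0 (I₀ n) x ∂(gaussianReal 0 1)) atTop (𝓝 α) := by
  simp only [conditionalFDR_zero, integral_const, probReal_univ, one_smul]
  refine tendsto_fdr_of_uniform hα0 (by linarith) (measurable_modelPValue 0 0) hζ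
    fun t h0 h1 => ?_
  obtain ⟨u, rfl⟩ := exists_upperTail_eq h0 h1
  rw [cdf_modelPValue one_pos]
  simp [shifted]

/-! ### The limit of vanishing correlation -/

/-- The crossing is exhibited at `u = c/√ρ`. There `v (u - v)` tends to `c (-c/2 - x)`, which
exceeds `c²/2 = -ln α` because `x < -c`. -/
lemma eventually_mem_crossingSet (hα0 : 0 < α) (hα : α ≤ 1 / 2) {x : ℝ}
    (hx : x < -√(-2 * Real.log α)) : ∀ᶠ ρ in 𝓝[>] (0 : ℝ), x ∈ crossingSet α ρ := by
  set c := √(-2 * Real.log α)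
  have hlog : Real.log α < 0 := Real.log_neg hα0 (by linarith)
  have hc : 0 < c := Real.sqrt_pos.2 (by linarith)
  have hc2 : c ^ 2 = -2 * Real.log α := Real.sq_sqrt (by linarith)
  have hcont : ContinuousAt (fun ρ : ℝ =>
      (c + ρ * x) * (-c / (1 + √(1 - ρ)) - x) / √(1 - ρ) ^ 2) 0 := by
    refine ContinuousAt.div (ContinuousAt.mul (by fun_prop)
      ((ContinuousAt.div (by fun_prop) (by fun_prop) (by simp)).sub (by fun_prop)))
      (by fun_prop) (by simp)
  have hval : -Real.log α < (c + 0 * x) * (-c / (1 + √(1 - 0)) - x) / √(1 - 0) ^ 2 := by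
    simp only [sub_zero, Real.sqrt_one, zero_mul, add_zero]
    nlinarith
  have hev1 := nhdsWithin_le_nhds (s := Set.Ioi 0) (hcont.eventually (lt_mem_nhds hval))
  have hev2 : ∀ᶠ ρ in 𝓝[>] (0 : ℝ), 0 < c + ρ * x := by
    have : ContinuousAt (fun ρ : ℝ => c + ρ * x) 0 := by fun_prop
    exact nhdsWithin_le_nhds (this.eventually (lt_mem_nhds (by simpa using hc)))
  filter_upwards [hev1, hev2, Ioo_mem_nhdsGT (zero_lt_one' ℝ)] with ρ h1 h2 hρ
  have hs : 0 < √ρ := Real.sqrt_pos.2 hρ.1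
  have hs2 : √ρ ^ 2 = ρ := Real.sq_sqrt hρ.1.le
  have hr : 0 < √(1 - ρ) := sqrt_one_sub_pos hρ.2
  have hr2 : √(1 - ρ) ^ 2 = 1 - ρ := Real.sq_sqrt (by linarith [hρ.2])
  set s := √ρ
  set r := √(1 - ρ)
  have hv : shifted ρ x (c / s) = (c + ρ * x) / (s * r) := by
    change (c / s + s * x) / r = _
    rw [← hs2]
    field_simp
  have huv : c / s - shifted ρ x (c / s) = s * (-c / (1 + r) - x) / r := by
    rw [hv]
    have h3 : s ^ 2 = (1 - r) * (1 + r) := by rw [hs2]; linear_combination hr2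
    have h1r : (1 + r) ≠ 0 := by positivity
    rw [← hs2]
    field_simp
    linear_combination c * h3
  have hprod : shifted ρ x (c / s) * (c / s - shifted ρ x (c / s)) =
      (c + ρ * x) * (-c / (1 + r) - x) / r ^ 2 := by
    rw [huv, hv]
    field_simp
  have hv0 : 0 < shifted ρ x (c / s) := by rw [hv]; positivity
  have hlt : shifted ρ x (c / s) < c / s := by
    have : 0 < shifted ρ x (c / s) * (c / s - shifted ρ x (c / s)) := by
      rw [hprod]; linarith
    have := (pos_iff_pos_of_mul_pos this).1 hv0
    linarith
  have hmain := mul_sub_le_log_upperTail hv0 hlt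
  rw [hprod] at hmain
  refine ⟨c / s, ?_⟩
  rw [← Real.log_lt_log_iff (div_pos (upperTail_pos _) hα0) (upperTail_pos _),
    Real.log_div (upperTail_pos _).ne' hα0.ne']
  linarith

lemma eventually_notMem_crossingSet_of_neg (hα0 : 0 < α) (hα : α ≤ 1 / 2) {b : ℝ} (hb : 0 < b)
    (hbc : b < √(-2 * Real.log α)) : ∀ᶠ ρ in 𝓝[>] (0 : ℝ), -b ∉ crossingSet α ρ := by
  have hlog : Real.log α < 0 := Real.log_neg hα0 (by linarith)
  have hb2 : b ^ 2 < -2 * Real.log α := (Real.lt_sqrt hb.le).1 hbc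
  have hev1 : ∀ᶠ ρ in 𝓝[>] (0 : ℝ), b ^ 2 / 2 + (√ρ * b) ^ 2 + √ρ * b < -Real.log α := by
    have : ContinuousAt (fun ρ : ℝ => b ^ 2 / 2 + (√ρ * b) ^ 2 + √ρ * b) 0 := by fun_prop
    exact nhdsWithin_le_nhds (this.eventually (gt_mem_nhds (by simp; linarith)))
  have hev2 : ∀ᶠ ρ in 𝓝[>] (0 : ℝ), 2 * (√ρ * b) < min (upperTail 2) 1 := by
    have : ContinuousAt (fun ρ : ℝ => 2 * (√ρ * b)) 0 := by fun_prop
    exact nhdsWithin_le_nhds (this.eventually (gt_mem_nhds (by simp [upperTail_pos])))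
  filter_upwards [hev1, hev2, Ioo_mem_nhdsGT (show (0 : ℝ) < 1 / 2 by norm_num)] with ρ h1 h2 hρ
  rintro ⟨u, hu⟩
  have hs : 0 < √ρ := Real.sqrt_pos.2 hρ.1
  have hs2 : √ρ ^ 2 = ρ := Real.sq_sqrt hρ.1.le
  have hr : 0 < √(1 - ρ) := sqrt_one_sub_pos (by linarith [hρ.2])
  have hr2 : √(1 - ρ) ^ 2 = 1 - ρ := Real.sq_sqrt (by linarith [hρ.2])
  have hrhalf : 1 / 2 ≤ √(1 - ρ) := Real.le_sqrt_of_sq_le (by linarith [hρ.2])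
  have hr1 : √(1 - ρ) ≤ 1 - ρ / 2 := by
    rw [Real.sqrt_le_left (by linarith [hρ.2])]; nlinarith [sq_nonneg ρ]
  set v := shifted ρ (-b) u with hv
  set s := √ρ
  set r := √(1 - ρ)
  have huv : u = r * v + s * b := by
    have : v * r = u + s * (-b) := by rw [hv]; exact div_mul_cancel₀ _ hr.ne'
    linarith
  have hsb : 0 < s * b := by positivity
  have h21 : 2 * (s * b) < 1 := h2.trans_le (min_le_right _ _)
  have h22 : 2 * (s * b) < upperTail 2 := h2.trans_le (min_le_left _ _)
  have hv0 : v < u := by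
    by_contra! h
    have := strictAnti_upperTail.antitone h
    have h3 : upperTail u ≤ upperTail u / α :=
      le_div_self (upperTail_pos u).le hα0 (by linarith)
    linarith
  -- For `v ≥ 1` the log-tail bound applies, with `v (u - v) ≤ b²/2` by completing the square. For
  -- `v < 1` the points `u` and `v` are too close for the tail to halve, as `α ≤ 1/2` would require;
  -- when `u ≤ 0` the tail at `u` is already at least `1/2`.
  rcases le_or_gt 1 v with h1v | h1v
  · have hmain := log_upperTail_le_mul_sub (by linarith : 0 < v) hv0
    have hlu := Real.log_lt_log (div_pos (upperTail_pos _) hα0) hu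
    rw [Real.log_div (upperTail_pos _).ne' hα0.ne'] at hlu
    have hd : u - v ≤ s * b - s ^ 2 / 2 * v := by rw [hs2]; nlinarith
    have hd2 : u - v ≤ s * b := by
      have : 0 ≤ s ^ 2 / 2 * v := by positivity
      linarith
    have hinv : 1 / v ≤ 1 := by rw [div_le_one (by linarith)]; exact h1v
    have hA : v * (u - v) ≤ b ^ 2 / 2 := by
      have := mul_le_mul_of_nonneg_left hd (by linarith : 0 ≤ v)
      nlinarith [sq_nonneg (s * v - b)]
    have hB : (u - v) * (u - v) ≤ (s * b) ^ 2 := by nlinarith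
    have hC : 1 / v * (u - v) ≤ s * b := by nlinarith
    have : (u + 1 / v) * (u - v) = v * (u - v) + (u - v) * (u - v) + 1 / v * (u - v) := by ring
    linarith
  · rw [div_lt_iff₀ hα0] at hu
    rcases le_or_gt u 0 with hu0 | hu0
    · have h3 : 1 / 2 ≤ upperTail u := by
        rw [← upperTail_zero]; exact strictAnti_upperTail.antitone hu0
      have h4 := upperTail_lt_one v
      have h9 := mul_le_mul_of_nonneg_left hα (upperTail_pos v).le
      linarith
    · have hrv : r * v ≤ 1 := by
        have := mul_le_mul_of_nonneg_left h1v.le hr.le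
        linarith [hρ.1]
      have h5 : u ≤ 2 := by linarith
      have h6 : upperTail 2 ≤ upperTail u := strictAnti_upperTail.antitone h5
      have h7 := upperTail_sub_le hv0.le
      have h8 : u - v ≤ 2 * (s * b) := by
        rcases le_or_gt 0 v with hv1 | hv1
        · have := mul_nonneg (by linarith [hρ.1] : 0 ≤ 1 - r) hv1
          linarith
        · have h9 := mul_le_mul_of_nonpos_right hrhalf hv1.le
          linarith
      have h9 := mul_le_mul_of_nonneg_left hα (upperTail_pos v).le
      linarith

lemma eventually_notMem_crossingSet (hα0 : 0 < α) (hα : α ≤ 1 / 2) {x : ℝ}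
    (hx : -√(-2 * Real.log α) < x) : ∀ᶠ ρ in 𝓝[>] (0 : ℝ), x ∉ crossingSet α ρ := by
  have hlog : Real.log α < 0 := Real.log_neg hα0 (by linarith)
  have hc : 0 < √(-2 * Real.log α) := Real.sqrt_pos.2 (by linarith)
  -- The crossing set is a lower set, so it is enough to exclude a negative point `y` below `x`.
  obtain ⟨y, hy1, hy2⟩ := exists_between (lt_min hx (neg_neg_of_pos hc))
  have h := eventually_notMem_crossingSet_of_neg hα0 hα (b := -y)
    (by linarith [hy2.trans_le (min_le_right _ _)]) (by linarith)
  filter_upwards [h, Ioo_mem_nhdsGT (zero_lt_one' ℝ)] with ρ h1 hρ h2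
  rw [neg_neg] at h1
  exact h1 (mem_crossingSet_of_lt hρ.1 hρ.2 (hy2.trans_le (min_le_left _ _)) h2)

lemma tendsto_measure_crossingSet (hα0 : 0 < α) (hα : α ≤ 1 / 2) :
    Tendsto (fun ρ => (gaussianReal 0 1).real (crossingSet α ρ)) (𝓝[>] 0)
      (𝓝 (Phi (-√(-2 * Real.log α)))) := by
  set c := -√(-2 * Real.log α)
  have hPhi : ∀ x, Phi x = (gaussianReal 0 1).real (Set.Iic x) := fun x => cdf_eq_real _ x
  refine tendsto_order.2 ⟨fun a ha => ?_, fun a ha => ?_⟩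
  · obtain ⟨x, hxa, hxc⟩ := ((continuous_Phi.continuousAt.eventually
      (lt_mem_nhds ha)).filter_mono nhdsWithin_le_nhds |>.and
        (self_mem_nhdsWithin (s := Set.Iio c))).exists
    filter_upwards [eventually_mem_crossingSet hα0 hα hxc, Ioo_mem_nhdsGT (zero_lt_one' ℝ)]
      with ρ h hρ
    refine hxa.trans_le ((hPhi x).trans_le (measureReal_mono fun y hy => ?_))
    rcases (Set.mem_Iic.1 hy).eq_or_lt with rfl | hy
    · exact h
    · exact mem_crossingSet_of_lt hρ.1 hρ.2 hy h
  · obtain ⟨x, hxa, hxc⟩ := ((continuous_Phi.continuousAt.eventually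
      (gt_mem_nhds ha)).filter_mono nhdsWithin_le_nhds |>.and
        (self_mem_nhdsWithin (s := Set.Ioi c))).exists
    filter_upwards [eventually_notMem_crossingSet hα0 hα hxc, Ioo_mem_nhdsGT (zero_lt_one' ℝ)]
      with ρ h hρ
    refine lt_of_le_of_lt ((measureReal_mono fun y hy => ?_).trans_eq (hPhi x).symm) hxa
    by_contra hyx
    exact h (mem_crossingSet_of_lt hρ.1 hρ.2 (not_le.1 hyx) hy)

end Model

end EquiNormal

end

theorem theorem3p3 (α : ℝ) (hα0 : 0 < α) (hα : α ≤ 1 / 2)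
    -- the sets of true hypotheses; their proportions `ζ_n` tend to `1`
    (I₀ : ∀ n : ℕ, Finset (Fin n))
    (hζ : Tendsto (fun n : ℕ => ((I₀ n).card : ℝ) / (n : ℝ)) atTop (𝓝 1))
    -- for every `n`, independent standard normal random variables `X_0, …, X_n`
    {Ω : ℕ → Type*} [∀ n, MeasurableSpace (Ω n)]
    (P : ∀ n, Measure (Ω n)) [∀ n, IsProbabilityMeasure (P n)]
    (X : ∀ n : ℕ, Fin (n + 1) → Ω n → ℝ)
    (hX : ∀ n j, HasLaw (X n j) (gaussianReal 0 1) (P n))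
    (hindep : ∀ n, iIndepFun (X n) (P n)) :
    ∃ FDRlim : ℝ → ℝ,
      -- the limiting false discovery rate exists for every correlation in `[0, 1)`
      (∀ ρ ∈ Set.Ico (0 : ℝ) 1,
        Tendsto (fun n : ℕ => EquiNormal.FDR α ρ (I₀ n) (P n) (X n)) atTop (𝓝 (FDRlim ρ))) ∧
      Tendsto FDRlim (𝓝[>] 0) (𝓝 (EquiNormal.Phi (-√(-2 * Real.log α)))) ∧
      EquiNormal.Phi (-√(-2 * Real.log α)) < α ∧
      FDRlim 0 = α ∧
      ¬ ContinuousWithinAt FDRlim (Set.Ico 0 1) 0 := by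
  have hlt := EquiNormal.Phi_neg_sqrt_lt hα0 hα
  -- The value at `0` is set apart: for `ρ = 0` the crossing set is empty, since `F_x(t) = t < t/α`,
  -- but `F_x(t)/t` does not tend to `0`.
  set L : ℝ → ℝ := fun ρ => if ρ = 0 then α
    else (gaussianReal 0 1).real (EquiNormal.crossingSet α ρ) with hL
  have hL0 : L 0 = α := by simp [hL]
  have hlim : Tendsto L (𝓝[>] 0) (𝓝 (EquiNormal.Phi (-√(-2 * Real.log α)))) := by
    refine (EquiNormal.tendsto_measure_crossingSet hα0 hα).congr' ?_
    filter_upwards [self_mem_nhdsWithin] with ρ hρ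
    simp [hL, (Set.mem_Ioi.1 hρ).ne']
  refine ⟨L, fun ρ hρ => ?_, hlim, hlt, hL0, fun hcont => ?_⟩
  · simp only [EquiNormal.FDR_eq_integral hα0.le (I₀ _) (hX _) (hindep _)]
    rcases hρ.1.eq_or_lt with rfl | hρ0
    · rw [hL0]
      exact EquiNormal.tendsto_integral_conditionalFDR_zero hα0 hα hζ
    · simp only [hL, hρ0.ne', if_false]
      exact EquiNormal.tendsto_integral_conditionalFDR hα0 hα hρ0 hρ.2 hζ
  · have h1 : Tendsto L (𝓝[>] 0) (𝓝 (L 0)) := by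
      refine hcont.tendsto.mono_left ?_
      rw [← nhdsWithin_Ioo_eq_nhdsGT (zero_lt_one' ℝ)]
      exact nhdsWithin_mono _ Set.Ioo_subset_Ico_self
    rw [hL0] at h1
    exact hlt.ne (tendsto_nhds_unique hlim h1)
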